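/- Let $V$ be a finite set of variables, and let $A$ be an architecture with $n\ge 2$ system processes: process $i$ has inputs $I_i\subseteq V$ and outputs $O_i\subseteq V$, with $I_i\cap O_i=\emptyset$, the $O_i$ pairwise disjoint and $V=\bigcup_i V_i$, where $V_i=I_i\cup O_i$. Put $\mathit{inp}=\bigcup_i I_i$, $\mathit{out}=\bigcup_i O_i$, $O_{env}=\mathit{inp}\setminus\mathit{out}$ and $O^G_i=O_i\cap\mathit{inp}$. Let $\varphi=\xi_1\wedge\dots\wedge\xi_k$ be an LTL formula over $V$, and let $\varphi_i$ be the conjunction of those $\xi_j$ that mention a variable of $O_i$ or no variable of $\mathit{out}$. Let $\mathcal B$ consist of positive integers $b_i,c_i$ ($1\le i\le n$). *Notions.* A transition system (TS) over inputs $I$ and outputs $O$ is a finite Moore machine with a partial transition function $T\times 2^{I}\rightharpoonup T$ and a labeling $o:T\to 2^{O}$; it is complete if this function is total. On $\gamma\in(2^I)^\omega$ it produces the computation $comp(s,\gamma)$ with letters $\gamma_k\cup o(t_k)$; if there is no transition at time $m$, this is the finite word of the letters at times $0,\dots,m$. A strategy for process $i$ is a complete TS over $I_i,O_i$; a guarantee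 transition system (GTS) is a complete TS over $I_i,O^G_i$; $s_i\preceq g_i$ means that $g_i$ simulates $s_i$ with respect to the outputs $O^G_i$. The formula $\varphi$ is *realizable in $A$* if there are strategies with $s_1\|\dots\|s_n\models\varphi$; it is *realizable in $A$ for the bounds $\mathcal B$* if there are such strategies and GTS $g_1,\dots,g_n$ with $s_i\preceq g_i$, where $s_i$ has at most $b_i$ and $g_i$ at most $c_i$ states. A finite word over $2^V$ is a valid history for $i$ if at each of its positions and for all $j\ne i$ its $O^G_j$-part is the output of $g_j$ on its $I_j$-part. A TS $s_i$ over $I_i,O_i$ is a *local strategy* with respect to $(g_j)_{j\neq i}$ if for all $\gamma$, $comp(s_i,\gamma)$ is infinite if and only if for some $\gamma'\in(2^{V\setminus V_i})^\omega$ all prefixes of $comp(s_i,\gamma)\cup\gamma'$ are valid histories for $i$ (prefixes no longer than the computation). It is a *restriction* of a TS $s$ if moreover each of its computations is a prefix of the computation of $s$ on the same input. Given universal co-Büchi automata $\mathcal A_i$ with $\mathcal L(\mathcal A_i)=\mathcal L(\varphi_i)$, a *solution of certifying synthesis with local strategies* consists of GTS $g_i$ and local strategies $s_i$ with respect to $(g_j)_{j\ne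 i}$ such that $s_i\preceq g_i$ and, for all $\gamma,\gamma'$, all runs of $\mathcal A_i$ on $comp(s_i,\gamma)\cup\gamma'$ visit rejecting states only finitely often (finite runs trivially do). *Constraint system.* $\mathcal C_{A,\varphi,\mathcal B}$ is the propositional formula, built from the automata $\mathcal A_i$, over variables for the transitions and labels of a TS $s_i$ with state set $T_i$, $|T_i|=b_i$, and of a TS $g_i$ with state set $G_i$, $|G_i|=c_i$ (initial states fixed), for relations $J_i\subseteq T_i\times\prod_kG_k$ and $R_i\subseteq T_i\times\prod_kG_k\times Q_i$ ($Q_i$ the states of $\mathcal A_i$), and for binary numbers $\lambda_i(t,w,q)$ with enough digits to represent $b_i\cdot\prod_kc_k\cdot|Q_i|$. Call $\sigma\subseteq V$ *valid* at $(t,w)$ if $\sigma\cap O_i$ is the label of $t$ and $\sigma\cap O^G_k$ is the label of $w_k$ for all $k\ne i$; then $\sigma$ leads to $(t',w')$ if $s_i$ moves from $t$ to $t'$ on $\sigma\cap I_i$ and each $g_k$ from $w_k$ to $w'_k$ on $\sigma\cap I_k$. The formula says for all $i$: (a) $g_i$ is deterministic and complete; (b) if $J_i(t,w)$, then the labels of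 $t$ and $w_i$ agree on $O^G_i$; (c) $J_i$ contains the initial pair and is closed under steps by valid letters; (d) $s_i$ is deterministic and has a transition from $t$ for $\sigma\cap I_i$ whenever $J_i(t,w)$ and $\sigma$ is valid at $(t,w)$; (e) $R_i$ contains the initial triple, and if $R_i(t,w,q)$, a valid letter $\sigma$ leads from $(t,w)$ to $(t',w')$, $\rho\cap V_i=\sigma\cap V_i$ and $q'$ is a $\rho$-successor of $q$ in $\mathcal A_i$, then $R_i(t',w',q')$ and $\lambda_i(t',w',q')\ge\lambda_i(t,w,q)$, with strict inequality if $q'$ is rejecting. **Theorem.** Universal co-Büchi automata $\mathcal A_i$ with $\mathcal L(\mathcal A_i)=\mathcal L(\varphi_i)$ exist, and for every choice of them the SAT constraint system $\mathcal C_{A,\varphi,\mathcal B}$ encodes local strategies and guarantee transition systems: every satisfying assignment describes TS $(s_i)$ and $(g_i)$ of sizes $b_i$ and $c_i$; and given TS $(s_i),(g_i)$ on these state sets with the fixed initial states are described by some satisfying assignment if and only if there are restrictions $s'_i$ of $s_i$ to local strategies with respect to $(g_j)_{j\ne i}$ such that $((s'_i)_i,(g_i)_i)$ is a solution of certifying synthesis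 with local strategies. Moreover: 1. if $\mathcal C_{A,\varphi,\mathcal B}$ is satisfiable, then $\varphi$ is realizable in $A$; 2. if $\varphi$ is realizable in $A$ for the bounds $\mathcal B$ and every $\varphi_i$ mentions only variables in $V_i$, then $\mathcal C_{A,\varphi,\mathcal B}$ is satisfiable. -/

import Mathlib

noncomputable section

namespace CertSynth

/-! ### Linear-time temporal logic -/

/-- LTL formulas over the atomic propositions `V`. -/
inductive LTL (V : Type*) where
  | atom : V → LTL V
  | neg : LTL V → LTL V
  | disj : LTL V → LTL V → LTL V
  | conj : LTL V → LTL V → LTL V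
  | next : LTL V → LTL V
  | untl : LTL V → LTL V → LTL V

/-- Satisfaction of an LTL formula by an infinite word over `2^V`. -/
def LTL.Sat {V : Type*} : LTL V → (ℕ → Finset V) → Prop
  | .atom a, σ => a ∈ σ 0
  | .neg φ, σ => ¬ φ.Sat σ
  | .disj φ ψ, σ => φ.Sat σ ∨ ψ.Sat σ
  | .conj φ ψ, σ => φ.Sat σ ∧ ψ.Sat σ
  | .next φ, σ => φ.Sat (fun m => σ (m + 1))
  | .untl φ ψ, σ =>
      ∃ k, ψ.Sat (fun m => σ (m + k)) ∧ ∀ j < k, φ.Sat (fun m => σ (m + j))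

/-- The atomic propositions occurring in a formula. -/
def LTL.props {V : Type*} [DecidableEq V] : LTL V → Finset V
  | .atom a => {a}
  | .neg φ => φ.props
  | .disj φ ψ => φ.props ∪ ψ.props
  | .conj φ ψ => φ.props ∪ ψ.props
  | .next φ => φ.props
  | .untl φ ψ => φ.props ∪ ψ.props

/-- A specification `ξ₁ ∧ … ∧ ξₖ`, represented by its conjuncts. -/
abbrev Spec (V : Type*) := List (LTL V)

/-- A word satisfies a specification if it satisfies every conjunct. -/
def Spec.Sat {V : Type*} (φ : Spec V) (σ : ℕ → Finset V) : Prop :=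
  ∀ ξ ∈ φ, ξ.Sat σ

/-! ### Universal co-Büchi automata -/

/-- A universal co-Büchi automaton over the alphabet `2^V`, with states `0, …, size - 1`. -/
structure UCB (V : Type*) where
  size : ℕ
  start : Fin size
  delta : Fin size → Finset V → Finset (Fin size)
  rejecting : Finset (Fin size)

/-- A word is accepted if every run on it visits rejecting states only finitely often. -/
def UCB.Accepts {V : Type*} (M : UCB V) (σ : ℕ → Finset V) : Prop :=
  ∀ r : ℕ → Fin M.size, r 0 = M.start → (∀ k, r (k + 1) ∈ M.delta (r k) (σ k)) →
    {k | r k ∈ M.rejecting}.Finite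

/-! ### Architectures -/

/-- Architectures with `n` system processes over the finite set `V` of variables. -/
structure Architecture (V : Type*) [Fintype V] [DecidableEq V] (n : ℕ) where
  inp : Fin n → Finset V
  out : Fin n → Finset V
  inp_disjoint_out : ∀ i, Disjoint (inp i) (out i)
  out_disjoint : ∀ i j, i ≠ j → Disjoint (out i) (out j)
  cover : ∀ v, ∃ i, v ∈ inp i ∪ out i

/-- Valuations of the variables in `X`, i.e. the elements of `2^X`. -/
abbrev Letter {V : Type*} (X : Finset V) := {e : Finset V // e ⊆ X}

/-- `σ ∩ X` as a valuation of the variables in `X`. -/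
def cut {V : Type*} [DecidableEq V] (X σ : Finset V) : Letter X :=
  ⟨σ ∩ X, Finset.inter_subset_right⟩

section Systems

variable {V : Type*} [Fintype V] [DecidableEq V] {n : ℕ}

namespace Architecture

/-- The variables of process `i`. -/
def vars (A : Architecture V n) (i : Fin n) : Finset V := A.inp i ∪ A.out i

def allInp (A : Architecture V n) : Finset V := Finset.univ.biUnion A.inp

def allOut (A : Architecture V n) : Finset V := Finset.univ.biUnion A.out

/-- The outputs of the environment: the inputs that no system process controls. -/
def envOut (A : Architecture V n) : Finset V := A.allInp \ A.allOut

/-- The guarantee output variables of process `i`. -/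
def guarOut (A : Architecture V n) (i : Fin n) : Finset V := A.out i ∩ A.allInp

end Architecture

open Classical in
/-- The subspecification of process `i`: the conjuncts that mention an output of process `i`
or no output of a system process at all. -/
def decomp (A : Architecture V n) (φ : Spec V) (i : Fin n) : Spec V :=
  φ.filter fun ξ => decide ((ξ.props ∩ A.out i).Nonempty ∨ ξ.props ∩ A.allOut = ∅)

/-! ### Transition systems and their computations -/

/-- Moore transition systems over inputs `I` and outputs `O` with state set `T` and a partial
transition function. -/
structure TS (I O : Finset V) (T : Type*) where
  start : T
  step : T → Letter I → Option T
  label : T → Letter O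

namespace TS

variable {I O : Finset V} {T : Type*}

/-- The transition function is total. -/
def Complete (s : TS I O T) : Prop := ∀ t e, (s.step t e).isSome

/-- The state at time `k` on the input sequence `γ`; `none` once the system got stuck. -/
def state (s : TS I O T) (γ : ℕ → Letter I) : ℕ → Option T
  | 0 => some s.start
  | k + 1 => (s.state γ k).bind fun t => s.step t (γ k)

/-- The computation on the input sequence `γ`: its letter at time `k` consists of the input at
time `k` and the label of the state at time `k`. If there is no transition at time `m`, the
computation is the finite word of the letters at the times `0, …, m`. -/
def comp (s : TS I O T) (γ : ℕ → Letter I) (k : ℕ) : Option (Finset V) :=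
  (s.state γ k).map fun t => (γ k).1 ∪ (s.label t).1

def InfiniteComp (s : TS I O T) (γ : ℕ → Letter I) : Prop :=
  ∀ k, (s.comp γ k).isSome

/-- The computation on `γ`, completed by the valuations `γ'` of the variables that the system
does not have. -/
def compWith (s : TS I O T) (γ : ℕ → Letter I)
    (γ' : ℕ → Letter (Finset.univ \ (I ∪ O))) (k : ℕ) : Option (Finset V) :=
  (s.comp γ k).map fun c => c ∪ (γ' k).1

/-- `s ⊨ φ` for a (complete) transition system `s`. -/
def Satisfies (s : TS I O T) (φ : Spec V) : Prop :=
  ∀ γ γ' (σ : ℕ → Finset V), (∀ k, s.compWith γ γ' k = some (σ k)) → φ.Sat σ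

/-- `s₂ ≼ s₁`: the transition system `s₁` with outputs `O₁` simulates `s₂`. -/
def SimulatedBy {O₁ : Finset V} {T₁ : Type*} (s₂ : TS I O T) (s₁ : TS I O₁ T₁) : Prop :=
  ∃ R : T → T₁ → Prop, R s₂.start s₁.start ∧
    ∀ t₂ t₁, R t₂ t₁ → (s₂.label t₂).1 ∩ O₁ = (s₁.label t₁).1 ∧
      ∀ e t₂', s₂.step t₂ e = some t₂' → ∃ t₁', s₁.step t₁ e = some t₁' ∧ R t₂' t₁'

end TS

section Synthesis

variable {T U : Fin n → Type*}

open Classical in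
/-- The parallel composition of strategies for all system processes. -/
def parallel (A : Architecture V n) (S : ∀ i, TS (A.inp i) (A.out i) (T i)) :
    TS A.envOut A.allOut (∀ i, T i) where
  start := fun i => (S i).start
  step := fun t e =>
    let letter : Finset V := e.1 ∪ Finset.univ.biUnion fun j => ((S j).label (t j)).1
    if h : ∀ i, ((S i).step (t i) (cut (A.inp i) letter)).isSome then
      some fun i => ((S i).step (t i) (cut (A.inp i) letter)).get (h i)
    else none
  label := fun t => ⟨Finset.univ.biUnion fun j => ((S j).label (t j)).1,
    Finset.biUnion_mono fun j _ => ((S j).label (t j)).2⟩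

/-- `φ` is realizable in `A`. -/
def Realizable (A : Architecture V n) (φ : Spec V) : Prop :=
  ∃ (m : Fin n → ℕ) (S : ∀ i, TS (A.inp i) (A.out i) (Fin (m i))),
    (∀ i, (S i).Complete) ∧ (parallel A S).Satisfies φ

/-- The finite sequence `h` of length `t` is a valid history with respect to the guarantee
transition systems `G j` of the processes `j ≠ i`. -/
def ValidHistory (A : Architecture V n) (G : ∀ i, TS (A.inp i) (A.guarOut i) (U i))
    (i : Fin n) (t : ℕ) (h : Fin t → Finset V) : Prop :=
  ∀ j, j ≠ i → ∀ k : Fin t, ∀ σ : ℕ → Finset V, (∀ m : Fin t, σ m = h m) →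
    ((G j).comp (fun m => cut (A.inp j) (σ m)) k).map (fun c => c ∩ A.guarOut j) =
      some (h k ∩ A.guarOut j)

/-- `s` is a local strategy for process `i` with respect to the guarantee transition systems of
the other processes: a computation is infinite if, and only if, for some valuations `γ'` of the
variables that process `i` does not have, all its prefixes are valid histories. -/
def IsLocalStrategy (A : Architecture V n) (G : ∀ i, TS (A.inp i) (A.guarOut i) (U i))
    (i : Fin n) {X : Type*} (s : TS (A.inp i) (A.out i) X) : Prop :=
  ∀ γ, s.InfiniteComp γ ↔ ∃ γ', ∀ (t : ℕ) (h : Fin t → Finset V),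
    (∀ k : Fin t, s.compWith γ γ' k = some (h k)) → ValidHistory A G i t h

/-- `s'` is the restriction of `s` to a local strategy: a local strategy whose computations are
those of `s` as long as they last. -/
def IsRestriction (A : Architecture V n) (G : ∀ i, TS (A.inp i) (A.guarOut i) (U i))
    (i : Fin n) {X X' : Type*} (s' : TS (A.inp i) (A.out i) X')
    (s : TS (A.inp i) (A.out i) X) : Prop :=
  IsLocalStrategy A G i s' ∧ ∀ γ k c, s'.comp γ k = some c → s.comp γ k = some c

/-- The automata `M i` represent the subspecifications of `φ`. -/
def Represents (A : Architecture V n) (φ : Spec V) (M : Fin n → UCB V) : Prop :=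
  ∀ i σ, (M i).Accepts σ ↔ (decomp A φ i).Sat σ

/-- `(S, G)` is a solution of certifying synthesis with local strategies for the
subspecifications represented by the automata `M i`. A run induced by a finite computation is
finite and hence visits rejecting states only finitely often, so only infinite computations are
constrained by the automata. -/
def IsLocalSolution (A : Architecture V n) (M : Fin n → UCB V)
    (S : ∀ i, TS (A.inp i) (A.out i) (T i))
    (G : ∀ i, TS (A.inp i) (A.guarOut i) (U i)) : Prop :=
  (∀ i, (G i).Complete) ∧
  ∀ i, IsLocalStrategy A G i (S i) ∧ (S i).SimulatedBy (G i) ∧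
    ∀ γ γ' (σ : ℕ → Finset V), (∀ k, (S i).compWith γ γ' k = some (σ k)) → (M i).Accepts σ

end Synthesis

/-- Bounds on the number of states of the strategies and of the guarantee transition systems. -/
structure Bounds (n : ℕ) where
  strat : Fin n → ℕ+
  cert : Fin n → ℕ+

/-- `φ` is realizable in `A` for the bounds `B`: there are strategies whose parallel composition
satisfies `φ` and certificates of these strategies, all of them within the bounds. -/
def RealizableWithin (A : Architecture V n) (φ : Spec V) (B : Bounds n) : Prop :=
  ∃ (m l : Fin n → ℕ) (S : ∀ i, TS (A.inp i) (A.out i) (Fin (m i)))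
    (G : ∀ i, TS (A.inp i) (A.guarOut i) (Fin (l i))),
    (∀ i, m i ≤ B.strat i ∧ l i ≤ B.cert i) ∧
    (∀ i, (S i).Complete ∧ (G i).Complete ∧ (S i).SimulatedBy (G i)) ∧
    (parallel A S).Satisfies φ

end Systems

/-! ### Propositional formulas -/

inductive PropForm (X : Type*) where
  | tru : PropForm X
  | fls : PropForm X
  | var : X → PropForm X
  | neg : PropForm X → PropForm X
  | and : PropForm X → PropForm X → PropForm X
  | or : PropForm X → PropForm X → PropForm X

namespace PropForm

variable {X : Type*}

def Eval (α : X → Prop) : PropForm X → Prop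
  | .tru => True
  | .fls => False
  | .var x => α x
  | .neg f => ¬ f.Eval α
  | .and f g => f.Eval α ∧ g.Eval α
  | .or f g => f.Eval α ∨ g.Eval α

def Satisfiable (f : PropForm X) : Prop := ∃ α : X → Prop, f.Eval α

def imp (f g : PropForm X) : PropForm X := .or (.neg f) g

def iff (f g : PropForm X) : PropForm X := .and (f.imp g) (g.imp f)

/-- The literal `x` if `p` holds, and `¬ x` otherwise. -/
def lit (x : X) (p : Prop) [Decidable p] : PropForm X :=
  if p then .var x else .neg (.var x)

/-- Finite conjunctions. -/
def all {ι : Type*} (s : Finset ι) (f : ι → PropForm X) : PropForm X :=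
  (s.toList.map f).foldr .and .tru

/-- Finite disjunctions. -/
def any {ι : Type*} (s : Finset ι) (f : ι → PropForm X) : PropForm X :=
  (s.toList.map f).foldr .or .fls

/-- The number with binary digits `a 0, …, a (L - 1)` (least significant first) is greater than
the one with digits `b 0, …, b (L - 1)`. -/
def bitsGt (a b : ℕ → X) : ℕ → PropForm X
  | 0 => .fls
  | L + 1 => .or (.and (.var (a L)) (.neg (.var (b L))))
      (.and (iff (.var (a L)) (.var (b L))) (bitsGt a b L))

def bitsGe (a b : ℕ → X) (L : ℕ) : PropForm X := .neg (bitsGt b a L)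

end PropForm

/-! ### The constraint system -/

section Constraints

variable {V : Type*} [Fintype V] [DecidableEq V] {n : ℕ}

/-- States of the strategy of process `i`. -/
abbrev Bounds.S (B : Bounds n) (i : Fin n) := Fin (B.strat i)

/-- States of the guarantee transition system of process `i`. -/
abbrev Bounds.G (B : Bounds n) (i : Fin n) := Fin (B.cert i)

def Bounds.s0 (B : Bounds n) (i : Fin n) : B.S i := ⟨0, (B.strat i).pos⟩

def Bounds.g0 (B : Bounds n) (i : Fin n) : B.G i := ⟨0, (B.cert i).pos⟩

/-- The propositional variables of the constraint system. -/
inductive CVar (A : Architecture V n) (M : Fin n → UCB V) (B : Bounds n) where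
  /-- The strategy of process `i` has the transition from `t` to `t'` for the input `e`. -/
  | trans (i : Fin n) (t : B.S i) (e : Letter (A.inp i)) (t' : B.S i)
  /-- The variable `v` belongs to the label of `t`. -/
  | label (i : Fin n) (t : B.S i) (v : V)
  /-- The guarantee transition system of process `i` has the transition from `u` to `u'`
  for the input `e`. -/
  | gtrans (i : Fin n) (u : B.G i) (e : Letter (A.inp i)) (u' : B.G i)
  /-- The variable `v` belongs to the label of `u`. -/
  | glabel (i : Fin n) (u : B.G i) (v : V)
  /-- The strategy of process `i` may be in state `t` while the guarantee transition systems are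
  in the states `w`, all other processes having kept to their guarantees so far. -/
  | joint (i : Fin n) (t : B.S i) (w : ∀ k, B.G k)
  /-- Likewise, with a run of the automaton of process `i` in state `q`. -/
  | reach (i : Fin n) (t : B.S i) (w : ∀ k, B.G k) (q : Fin (M i).size)
  /-- Binary digit number `d` of the annotation of such a node. -/
  | bit (i : Fin n) (t : B.S i) (w : ∀ k, B.G k) (q : Fin (M i).size) (d : ℕ)

open PropForm

variable (A : Architecture V n) (M : Fin n → UCB V) (B : Bounds n)

/-- The letter `σ` may occur at the node `(t, w)`: the outputs of process `i` are those of `t`,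
and the outputs of the other processes are the guaranteed ones. -/
def validLetter (i : Fin n) (t : B.S i) (w : ∀ k, B.G k) (σ : Finset V) :
    PropForm (CVar A M B) :=
  .and (all (A.out i) fun v => lit (.label i t v) (v ∈ σ))
    (all (Finset.univ.erase i) fun k =>
      all (A.guarOut k) fun v => lit (.glabel k (w k) v) (v ∈ σ))

/-- The letter `σ` leads from `(t, w)` to `(t', w')`. -/
def jointStep (i : Fin n) (t : B.S i) (w : ∀ k, B.G k) (σ : Finset V)
    (t' : B.S i) (w' : ∀ k, B.G k) : PropForm (CVar A M B) :=
  .and (.var (.trans i t (cut (A.inp i) σ) t'))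
    (all Finset.univ fun k => .var (.gtrans k (w k) (cut (A.inp k) σ) (w' k)))

/-- Number of binary digits of the annotations, enough for the number of nodes. -/
def numBits (i : Fin n) : ℕ :=
  Nat.size (B.strat i * (∏ k, (B.cert k : ℕ)) * (M i).size)

/-- (a) The guarantee transition system is deterministic and complete. -/
def guarComplete (i : Fin n) : PropForm (CVar A M B) :=
  all Finset.univ fun u : B.G i => all Finset.univ fun e : Letter (A.inp i) =>
    .and (any Finset.univ fun u' => .var (.gtrans i u e u'))
      (all Finset.univ fun u' => all (Finset.univ.erase u') fun u'' =>
        .or (.neg (.var (.gtrans i u e u'))) (.neg (.var (.gtrans i u e u''))))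

/-- (b) The strategy keeps to its own certificate. -/
def ownCertificate (i : Fin n) : PropForm (CVar A M B) :=
  all Finset.univ fun t : B.S i => all Finset.univ fun w : (∀ k, B.G k) =>
    (PropForm.var (.joint i t w)).imp
      (all (A.guarOut i) fun v =>
        PropForm.iff (.var (.label i t v)) (.var (.glabel i (w i) v)))

/-- (c) The joint behavior of the strategy and the guarantee transition systems. -/
def jointBehavior (i : Fin n) : PropForm (CVar A M B) :=
  .and (.var (.joint i (B.s0 i) B.g0))
    (all Finset.univ fun t : B.S i => all Finset.univ fun w : (∀ k, B.G k) =>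
      (PropForm.var (.joint i t w)).imp
        (all Finset.univ fun σ : Finset V => (validLetter A M B i t w σ).imp
          (all Finset.univ fun t' : B.S i => all Finset.univ fun w' : (∀ k, B.G k) =>
            (jointStep A M B i t w σ t' w').imp (.var (.joint i t' w')))))

/-- (d) The strategy is deterministic and has a transition for every input that may occur while
the other processes keep to their guarantees. -/
def stratTransitions (i : Fin n) : PropForm (CVar A M B) :=
  .and
    (all Finset.univ fun t : B.S i => all Finset.univ fun w : (∀ k, B.G k) =>
      (PropForm.var (.joint i t w)).imp
        (all Finset.univ fun σ : Finset V => (validLetter A M B i t w σ).imp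
          (any Finset.univ fun t' : B.S i => .var (.trans i t (cut (A.inp i) σ) t'))))
    (all Finset.univ fun t : B.S i => all Finset.univ fun e : Letter (A.inp i) =>
      all Finset.univ fun t' => all (Finset.univ.erase t') fun t'' =>
        .or (.neg (.var (.trans i t e t'))) (.neg (.var (.trans i t e t''))))

/-- The annotation of `(t', w', q')` is at least that of `(t, w, q)`, and greater if `q'` is
rejecting. -/
def boundStep (i : Fin n) (t : B.S i) (w : ∀ k, B.G k) (q : Fin (M i).size)
    (t' : B.S i) (w' : ∀ k, B.G k) (q' : Fin (M i).size) : PropForm (CVar A M B) :=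
  if q' ∈ (M i).rejecting then
    bitsGt (CVar.bit i t' w' q') (CVar.bit i t w q) (numBits M B i)
  else
    bitsGe (CVar.bit i t' w' q') (CVar.bit i t w q) (numBits M B i)

/-- (e) The run graph has a valid annotation. The automaton reads a letter `ρ` that agrees with
`σ` on the variables of process `i` and is arbitrary elsewhere. -/
def validAnnotation (i : Fin n) : PropForm (CVar A M B) :=
  .and (.var (.reach i (B.s0 i) B.g0 (M i).start))
    (all Finset.univ fun t : B.S i => all Finset.univ fun w : (∀ k, B.G k) =>
      all Finset.univ fun q : Fin (M i).size =>
        (PropForm.var (.reach i t w q)).imp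
          (all Finset.univ fun σ : Finset V => (validLetter A M B i t w σ).imp
            (all Finset.univ fun t' : B.S i => all Finset.univ fun w' : (∀ k, B.G k) =>
              (jointStep A M B i t w σ t' w').imp
                (all (Finset.univ.filter fun ρ : Finset V => ρ ∩ A.vars i = σ ∩ A.vars i)
                  fun ρ => all ((M i).delta q ρ) fun q' =>
                    .and (.var (.reach i t' w' q')) (boundStep A M B i t w q t' w' q')))))

/-- The SAT constraint system. -/
def constraintSystem : PropForm (CVar A M B) :=
  all Finset.univ fun i : Fin n =>
    .and (guarComplete A M B i) (.and (ownCertificate A M B i) (.and (jointBehavior A M B i)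
      (.and (stratTransitions A M B i) (validAnnotation A M B i))))

variable {A M B}

/-- The assignment `α` describes the transition systems `S i` and `G i`, whose initial states
are the states with number `0`. -/
def Describes (α : CVar A M B → Prop) (S : ∀ i, TS (A.inp i) (A.out i) (B.S i))
    (G : ∀ i, TS (A.inp i) (A.guarOut i) (B.G i)) : Prop :=
  ∀ i,
    ((S i).start = B.s0 i ∧
      (∀ t e t', α (.trans i t e t') ↔ (S i).step t e = some t') ∧
      ∀ t, ∀ v ∈ A.out i, α (.label i t v) ↔ v ∈ ((S i).label t).1) ∧
    ((G i).start = B.g0 i ∧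
      (∀ u e u', α (.gtrans i u e u') ↔ (G i).step u e = some u') ∧
      ∀ u, ∀ v ∈ A.guarOut i, α (.glabel i u v) ↔ v ∈ ((G i).label u).1)

end Constraints

end CertSynth

end

noncomputable section

namespace CertSynth

/-! ### Universal co-Büchi automata for LTL specifications -/

section Tableau

variable {V : Type*}

/-! The argument turns on one semantic notion, `Certified`, which speaks about words over all
variables instead of computations and completions. Consider words on which process `i` follows its
strategy and every other process emits its guaranteed outputs. On such words a certified strategy
matches its own certificate, never gets stuck, and is accepted by the automaton even after the
variables outside `V_i` are altered. With all `G i` complete, both sides of the central equivalence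
say that every `S i` is certified.

Constraint system and certification (`certified_of_eval`, `exists_eval_of_certified`): the relations
`joint` and `reach` contain everything reachable in the product, and an annotation that is bounded,
monotone and strictly increasing at rejecting states allows only finitely many rejecting visits on a
run. Conversely, reachability itself satisfies the closure constraints, and a node can be annotated
by the number of reachable rejecting nodes from which it is reachable. An edge into a rejecting node
raises this number, since otherwise the node would lie on a reachable cycle, which unrolls to a run
with infinitely many rejecting visits.

Restrictions and certification (`exists_isRestriction_of_certified`, `certified_of_isRestriction`):
a subset construction tracks which states of the guarantee systems are still possible and stops when
there are none. Compactness of the space of words turns an infinite computation of the result into a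
single word on which the others keep to their guarantees. Conversely, a local strategy cannot stop
on such a word, so it passes its properties on to the unrestricted strategy.

Soundness is an induction on time: if all processes have kept to their guarantees so far, each
certified strategy does so at the next moment. For the other direction,
`exists_joint_computation_of_keeps` shows that a process cannot distinguish guarantee systems from
the strategies behind them, so formulas over `V_i` carry over from a joint computation.

The automata are dual to Büchi tableaux for the negation: a run guesses which subformulas hold,
starting with a violated conjunct, and rejecting states are the breakpoints that certify the guess
to be fair. -/

/-- Universal co-Büchi automata may be given on an arbitrary finite set of states. -/
theorem exists_ucb_of_finite {Q : Type*} [Finite Q] (q₀ : Q) (δ : Q → Finset V → Q → Prop)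
    (rej : Q → Prop) :
    ∃ M : UCB V, ∀ σ, M.Accepts σ ↔ ∀ r : ℕ → Q, r 0 = q₀ →
      (∀ k, δ (r k) (σ k) (r (k + 1))) → {k | rej (r k)}.Finite := by
  classical
  obtain ⟨N, ⟨e⟩⟩ := Finite.exists_equiv_fin Q
  refine ⟨⟨N, e q₀, fun q a => Finset.univ.filter fun q' => δ (e.symm q) a (e.symm q'),
    Finset.univ.filter fun q => rej (e.symm q)⟩, fun σ => ?_⟩
  simp only [UCB.Accepts, Finset.mem_filter, Finset.mem_univ, true_and]
  constructor
  · intro h r h0 hs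
    simpa using h (fun k => e (r k)) (by simp [h0]) (by simpa using hs)
  · intro h r h0 hs
    exact h (fun k => e.symm (r k)) (by simp [h0]) hs

namespace LTL

/-- Closure of a set of formulas under immediate subformulas. -/
def Closed (C : Finset (LTL V)) : Prop :=
  (∀ f, neg f ∈ C → f ∈ C) ∧ (∀ f g, disj f g ∈ C → f ∈ C ∧ g ∈ C) ∧
  (∀ f g, conj f g ∈ C → f ∈ C ∧ g ∈ C) ∧ (∀ f, next f ∈ C → f ∈ C) ∧
  (∀ f g, untl f g ∈ C → f ∈ C ∧ g ∈ C)

open Classical in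
theorem Closed.union {C D : Finset (LTL V)} (hC : Closed C) (hD : Closed D) :
    Closed (C ∪ D) := by
  obtain ⟨c1, c2, c3, c4, c5⟩ := hC
  obtain ⟨d1, d2, d3, d4, d5⟩ := hD
  simp only [Closed, Finset.mem_union]
  refine ⟨?_, ?_, ?_, ?_, ?_⟩
  · rintro f (h | h)
    exacts [.inl (c1 f h), .inr (d1 f h)]
  · rintro f g (h | h)
    exacts [⟨.inl (c2 f g h).1, .inl (c2 f g h).2⟩, ⟨.inr (d2 f g h).1, .inr (d2 f g h).2⟩]
  · rintro f g (h | h)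
    exacts [⟨.inl (c3 f g h).1, .inl (c3 f g h).2⟩, ⟨.inr (d3 f g h).1, .inr (d3 f g h).2⟩]
  · rintro f (h | h)
    exacts [.inl (c4 f h), .inr (d4 f h)]
  · rintro f g (h | h)
    exacts [⟨.inl (c5 f g h).1, .inl (c5 f g h).2⟩, ⟨.inr (d5 f g h).1, .inr (d5 f g h).2⟩]

theorem exists_closed (f : LTL V) : ∃ C, Closed C ∧ f ∈ C := by
  classical
  induction f with
  | atom a => exact ⟨{atom a}, by simp [Closed], by simp⟩
  | neg f ih =>
    obtain ⟨C, ⟨h1, h2, h3, h4, h5⟩, hf⟩ := ih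
    refine ⟨insert (neg f) C, ?_, by simp⟩
    simp only [Closed, Finset.mem_insert, reduceCtorEq, false_or, neg.injEq]
    refine ⟨?_, ?_, ?_, ?_, ?_⟩ <;> grind
  | next f ih =>
    obtain ⟨C, ⟨h1, h2, h3, h4, h5⟩, hf⟩ := ih
    refine ⟨insert (next f) C, ?_, by simp⟩
    simp only [Closed, Finset.mem_insert, reduceCtorEq, false_or, next.injEq]
    refine ⟨?_, ?_, ?_, ?_, ?_⟩ <;> grind
  | disj f g ihf ihg =>
    obtain ⟨C, hC, hf⟩ := ihf
    obtain ⟨D, hD, hg⟩ := ihg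
    obtain ⟨h1, h2, h3, h4, h5⟩ := hC.union hD
    refine ⟨insert (disj f g) (C ∪ D), ?_, by simp⟩
    simp only [Closed, Finset.mem_insert, reduceCtorEq, false_or, disj.injEq]
    refine ⟨?_, ?_, ?_, ?_, ?_⟩ <;> grind
  | conj f g ihf ihg =>
    obtain ⟨C, hC, hf⟩ := ihf
    obtain ⟨D, hD, hg⟩ := ihg
    obtain ⟨h1, h2, h3, h4, h5⟩ := hC.union hD
    refine ⟨insert (conj f g) (C ∪ D), ?_, by simp⟩
    simp only [Closed, Finset.mem_insert, reduceCtorEq, false_or, conj.injEq]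
    refine ⟨?_, ?_, ?_, ?_, ?_⟩ <;> grind
  | untl f g ihf ihg =>
    obtain ⟨C, hC, hf⟩ := ihf
    obtain ⟨D, hD, hg⟩ := ihg
    obtain ⟨h1, h2, h3, h4, h5⟩ := hC.union hD
    refine ⟨insert (untl f g) (C ∪ D), ?_, by simp⟩
    simp only [Closed, Finset.mem_insert, reduceCtorEq, false_or, untl.injEq]
    refine ⟨?_, ?_, ?_, ?_, ?_⟩ <;> grind

theorem exists_closed_of_spec (φ : Spec V) : ∃ C, Closed C ∧ ∀ ξ ∈ φ, ξ ∈ C := by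
  classical
  induction φ with
  | nil => exact ⟨∅, by simp [Closed], by simp⟩
  | cons ξ φ ih =>
    obtain ⟨C, hC, h⟩ := ih
    obtain ⟨D, hD, hξ⟩ := exists_closed ξ
    exact ⟨C ∪ D, hC.union hD, by grind⟩

/-- The set `H` of formulas is consistent with the letter `a` at the formula. -/
def Now (a : Finset V) (H : Finset (LTL V)) : LTL V → Prop
  | atom v => atom v ∈ H ↔ v ∈ a
  | neg f => neg f ∈ H ↔ f ∉ H
  | disj f g => disj f g ∈ H ↔ f ∈ H ∨ g ∈ H
  | conj f g => conj f g ∈ H ↔ f ∈ H ∧ g ∈ H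
  | next _ => True
  | untl _ _ => True

/-- The sets `H` and `H'` of formulas are consistent as sets of true formulas at successive
times. -/
def Later (H H' : Finset (LTL V)) : LTL V → Prop
  | next f => next f ∈ H ↔ f ∈ H'
  | untl f g => untl f g ∈ H ↔ g ∈ H ∨ (f ∈ H ∧ untl f g ∈ H')
  | _ => True

/-- The formula is an until formula in `H` whose second argument is not in `H`. -/
def Pending (H : Finset (LTL V)) : LTL V → Prop
  | untl f g => untl f g ∈ H ∧ g ∉ H
  | _ => False

/-- The expansion law for until, at absolute times, because the tableau labels positions of one
fixed word. -/
theorem sat_untl_iff (f g : LTL V) (σ : ℕ → Finset V) (k : ℕ) :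
    (untl f g).Sat (fun m => σ (m + k)) ↔ g.Sat (fun m => σ (m + k)) ∨
      (f.Sat (fun m => σ (m + k)) ∧ (untl f g).Sat (fun m => σ (m + (k + 1)))) := by
  simp only [Sat]
  constructor
  · rintro ⟨j, hj, h⟩
    rcases j with _ | j
    · left; simpa using hj
    · right
      refine ⟨by simpa using h 0 (by omega), j, ?_, fun l hl => ?_⟩
      · convert hj using 3; omega
      · convert h (l + 1) (by omega) using 3; omega
  · rintro (h | ⟨h, j, hj, hl⟩)
    · exact ⟨0, by simpa using h, by simp⟩
    · refine ⟨j + 1, ?_, fun l hl' => ?_⟩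
      · convert hj using 3; omega
      · rcases l with _ | l
        · simpa using h
        · convert hl l (by omega) using 3; omega

/-- A locally consistent labeling of time by sets of formulas in which no until formula is
pending forever consists of the sets of true formulas. -/
theorem mem_iff_sat_of_consistent {C : Finset (LTL V)} (hC : Closed C) {σ : ℕ → Finset V}
    {H : ℕ → Finset (LTL V)} (hnow : ∀ k, ∀ f ∈ C, Now (σ k) (H k) f)
    (hlater : ∀ k, ∀ f ∈ C, Later (H k) (H (k + 1)) f)
    (hfair : ∀ f ∈ C, ∀ k, ∃ j ≥ k, ¬ Pending (H j) f) :
    ∀ f ∈ C, ∀ k, f ∈ H k ↔ f.Sat (fun m => σ (m + k)) := by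
  obtain ⟨h1, h2, h3, h4, h5⟩ := hC
  intro f
  induction f with
  | atom a => intro hf k; simpa [Now, Sat] using hnow k _ hf
  | neg f ih =>
    intro hf k
    have := hnow k _ hf
    simp only [Now, Sat] at this ⊢
    rw [this, ih (h1 _ hf)]
  | disj f g ihf ihg =>
    intro hf k
    have := hnow k _ hf
    simp only [Now, Sat] at this ⊢
    rw [this, ihf (h2 _ _ hf).1, ihg (h2 _ _ hf).2]
  | conj f g ihf ihg =>
    intro hf k
    have := hnow k _ hf
    simp only [Now, Sat] at this ⊢
    rw [this, ihf (h3 _ _ hf).1, ihg (h3 _ _ hf).2]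
  | next f ih =>
    intro hf k
    have := hlater k _ hf
    simp only [Later, Sat] at this ⊢
    rw [this, ih (h4 _ hf)]
    have e : ∀ m, m + 1 + k = m + (k + 1) := by intro m; omega
    simp only [e]
  | untl f g ihf ihg =>
    intro hfg k
    have hl : ∀ k, untl f g ∈ H k ↔ g ∈ H k ∨ (f ∈ H k ∧ untl f g ∈ H (k + 1)) :=
      fun k => hlater k _ hfg
    have hF := ihf (h5 _ _ hfg).1
    have hG := ihg (h5 _ _ hfg).2
    constructor
    · intro h
      -- Fairness gives a time at which the formula is not pending. Induction on the distance to it: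
      -- the expansion law postpones the formula until then, where its second argument must hold.
      obtain ⟨j, hj, hp⟩ := hfair _ hfg k
      obtain ⟨d, rfl⟩ := Nat.exists_eq_add_of_le hj
      clear hj
      induction d generalizing k with
      | zero =>
        simp only [Pending, add_zero, not_and, not_not] at hp
        rw [sat_untl_iff]
        exact .inl ((hG k).1 (hp h))
      | succ d ih =>
        rw [sat_untl_iff]
        rcases (hl k).1 h with h | ⟨h, h'⟩
        · exact .inl ((hG k).1 h)
        · refine .inr ⟨(hF k).1 h, ih (k + 1) h' ?_⟩
          rwa [show k + 1 + d = k + (d + 1) by omega]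
    · simp only [Sat]
      rintro ⟨j, hj, hjl⟩
      induction j generalizing k with
      | zero => exact (hl k).2 (.inl ((hG k).2 (by simpa using hj)))
      | succ j ih =>
        refine (hl k).2 (.inr ⟨(hF k).2 (by simpa using hjl 0 (by omega)), ih (k + 1) ?_ ?_⟩)
        · convert hj using 3; omega
        · intro l hl'
          convert hjl (l + 1) (by omega) using 3; omega

end LTL

open LTL in
/-- Every LTL specification is recognized by a universal co-Büchi automaton. -/
theorem exists_ucb_accepts_iff_sat (φ : Spec V) :
    ∃ M : UCB V, ∀ σ, M.Accepts σ ↔ φ.Sat σ := by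
  classical
  obtain ⟨C, hC, hφ⟩ := exists_closed_of_spec φ
  -- Breakpoint construction: `O` holds the until formulas pending ever since the last breakpoint.
  -- It only shrinks until it is empty, and then it is reloaded with all pending ones.
  let next : Finset (LTL V) → Finset (LTL V) → Finset (LTL V) := fun O H =>
    if O = ∅ then C.filter (Pending H) else O.filter (Pending H)
  -- The state entered on reading the letter at time `k` guesses the formulas true at time `k`; the
  -- extra state `none` precedes the first guess, which must leave out a conjunct of `φ`.
  let δ : Option (C.powerset × C.powerset) → Finset V → Option (C.powerset × C.powerset) → Prop :=
    fun q a q' => match q, q' with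
      | none, some (H, O) => (∀ f ∈ C, Now a H.1 f) ∧ (∃ ξ ∈ φ, ξ ∉ H.1) ∧ O.1 = ∅
      | some (H, O), some (H', O') => (∀ f ∈ C, Now a H'.1 f) ∧ (∀ f ∈ C, Later H.1 H'.1 f) ∧
          O'.1 = next O.1 H'.1
      | _, none => False
  obtain ⟨M, hM⟩ := exists_ucb_of_finite (V := V) none δ
    (fun q => ∃ H O, q = some (H, O) ∧ O.1 = ∅)
  refine ⟨M, fun σ => (hM σ).trans ?_⟩
  constructor
  · intro h
    by_contra hn
    simp only [Spec.Sat, not_forall] at hn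
    obtain ⟨ξ, hξ, hns⟩ := hn
    -- For a violated specification, guessing the truth is a legal run; the second component is then
    -- forced.
    let H : ℕ → Finset (LTL V) := fun k => C.filter fun f => f.Sat fun m => σ (m + k)
    let O : ℕ → Finset (LTL V) := fun k => Nat.rec ∅ (fun k o => next o (H (k + 1))) k
    have hO : ∀ k, O (k + 1) = next (O k) (H (k + 1)) := fun k => rfl
    have hOC : ∀ k, O k ⊆ C := by
      intro k
      induction k with
      | zero => exact Finset.empty_subset _
      | succ k ih =>
        intro f hf
        rw [hO] at hf
        rcases eq_or_ne (O k) ∅ with h0 | h0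
        · simp only [next, if_pos h0, Finset.mem_filter] at hf
          exact hf.1
        · simp only [next, if_neg h0, Finset.mem_filter] at hf
          exact ih hf.1
    have hH : ∀ k, ∀ f ∈ C, f ∈ H k ↔ f.Sat fun m => σ (m + k) := by
      intro k f hf
      simp [H, hf]
    obtain ⟨h1, h2, h3, h4, h5⟩ := hC
    have hnow : ∀ k, ∀ f ∈ C, Now (σ k) (H k) f := by
      intro k f hf
      cases f with
      | atom a => simp [Now, hH k _ hf, Sat]
      | neg f => simp [Now, hH k _ hf, hH k _ (h1 _ hf), Sat]
      | disj f g => simp [Now, hH k _ hf, hH k _ (h2 _ _ hf).1, hH k _ (h2 _ _ hf).2, Sat]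
      | conj f g => simp [Now, hH k _ hf, hH k _ (h3 _ _ hf).1, hH k _ (h3 _ _ hf).2, Sat]
      | next f => trivial
      | untl f g => trivial
    have hlater : ∀ k, ∀ f ∈ C, Later (H k) (H (k + 1)) f := by
      intro k f hf
      cases f with
      | next f =>
        have e : ∀ m, m + 1 + k = m + (k + 1) := by intro m; omega
        simp [Later, hH k _ hf, hH (k + 1) _ (h4 _ hf), Sat, e]
      | untl f g =>
        simp only [Later]
        rw [hH k _ hf, hH k _ (h5 _ _ hf).1, hH k _ (h5 _ _ hf).2, hH (k + 1) _ hf]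
        exact sat_untl_iff f g σ k
      | _ => trivial
    let r : ℕ → Option (C.powerset × C.powerset) := fun k => match k with
      | 0 => none
      | k + 1 => some (⟨H k, Finset.mem_powerset.2 (Finset.filter_subset _ _)⟩,
          ⟨O k, Finset.mem_powerset.2 (hOC k)⟩)
    have hfin := h r rfl (by
      intro k
      rcases k with _ | k
      · refine ⟨hnow 0, ⟨ξ, hξ, ?_⟩, rfl⟩
        change ξ ∉ H 0
        rw [hH 0 ξ (hφ ξ hξ)]
        exact hns
      · exact ⟨hnow (k + 1), hlater k, hO k⟩)
    -- After `K` there are no breakpoints, so `O` is nonempty and only shrinks. Yet each of the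
    -- finitely many members of `O K` stops pending at some later time `J f`, so none survives past
    -- the maximum of these times.
    obtain ⟨K, hK⟩ := hfin.bddAbove
    have hne : ∀ k ≥ K, O k ≠ ∅ := by
      intro k hk h0
      have : k + 1 ≤ K := hK ⟨_, _, rfl, h0⟩
      omega
    have hsub : ∀ d f, f ∈ O (K + d) → f ∈ O K ∧ ∀ j, K < j → j ≤ K + d → Pending (H j) f := by
      intro d
      induction d with
      | zero => exact fun f hf => ⟨hf, by intros; omega⟩
      | succ d ih =>
        intro f hf
        rw [← add_assoc, hO] at hf
        simp only [next, if_neg (hne (K + d) (by omega)), Finset.mem_filter] at hf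
        refine ⟨(ih f hf.1).1, fun j hj hj' => ?_⟩
        rcases Nat.lt_or_ge (K + d) j with hlt | hge
        · obtain rfl : j = K + d + 1 := by omega
          exact hf.2
        · exact (ih f hf.1).2 j hj hge
    have hful : ∀ f ∈ O K, ∃ j > K, ¬ Pending (H j) f := by
      intro f hf
      by_contra hall
      push Not at hall
      cases f with
      | untl f g =>
        have hfC := hOC K hf
        have hp := hall (K + 1) (by omega)
        obtain ⟨j, hj, -⟩ := (hH _ _ hfC).1 hp.1
        have hq := (hall (K + 1 + j) (by omega)).2
        rw [hH _ _ (h5 _ _ hfC).2] at hq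
        apply hq
        convert hj using 3; omega
      | _ => exact hall (K + 1) (by omega)
    choose! J hJ hJp using hful
    obtain ⟨f, hf⟩ := Finset.nonempty_iff_ne_empty.2 (hne (K + (O K).sup J) (by omega))
    obtain ⟨hfK, hp⟩ := hsub _ f hf
    exact hJp f hfK (hp (J f) (hJ f hfK)
      ((Finset.le_sup (f := J) hfK).trans (by omega)))
  · intro hsat r hr0 hr
    by_contra hinf
    have hsome : ∀ k, ∃ p, r (k + 1) = some p := by
      intro k
      have := hr k
      cases h : r (k + 1) with
      | none => rw [h] at this; cases h' : r k <;> simp [δ, h'] at this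
      | some p => exact ⟨p, rfl⟩
    choose p hp using hsome
    have hd0 := hr 0
    rw [hr0, hp 0] at hd0
    have hds : ∀ k, δ (some (p k)) (σ (k + 1)) (some (p (k + 1))) := by
      intro k
      have := hr (k + 1)
      rwa [hp k, hp (k + 1)] at this
    have hnow : ∀ k, ∀ f ∈ C, Now (σ k) (p k).1.1 f := by
      intro k
      cases k with
      | zero => exact hd0.1
      | succ k => exact (hds k).1
    have hO : ∀ k, (p (k + 1)).2.1 = next (p k).2.1 (p (k + 1)).1.1 := fun k => (hds k).2.2
    have hio : ∀ k, ∃ j ≥ k, (p j).2.1 = ∅ := by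
      intro k
      by_contra hk
      push Not at hk
      apply hinf
      refine (Set.finite_le_nat k).subset ?_
      rintro m ⟨H, O, hm, hOm⟩
      rcases m with _ | m
      · exact Nat.zero_le _
      · by_contra hlt
        rw [Set.mem_ofPred_eq, not_le] at hlt
        have := hk m (by omega)
        rw [hp m] at hm
        rw [Option.some.inj hm] at this
        exact this.ne_empty hOm
    have hfair : ∀ f ∈ C, ∀ k, ∃ j ≥ k, ¬ Pending (p j).1.1 f := by
      intro f hf k
      by_contra hall
      push Not at hall
      obtain ⟨j, hj, hj0⟩ := hio k
      -- A formula pending forever is loaded at the breakpoint `j` and never leaves, which excludes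
      -- any further breakpoint.
      have hmem : ∀ d, f ∈ (p (j + 1 + d)).2.1 := by
        intro d
        induction d with
        | zero =>
          rw [add_zero, hO j]
          simp only [next, if_pos hj0, Finset.mem_filter]
          exact ⟨hf, hall _ (by omega)⟩
        | succ d ih =>
          rw [← add_assoc, hO]
          simp only [next, if_neg (Finset.ne_empty_of_mem ih), Finset.mem_filter]
          exact ⟨ih, hall _ (by omega)⟩
      obtain ⟨l, hl, hl0⟩ := hio (j + 1)
      obtain ⟨d, rfl⟩ := Nat.exists_eq_add_of_le hl
      have := hmem d
      rw [hl0] at this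
      exact Finset.notMem_empty _ this
    have key := mem_iff_sat_of_consistent hC hnow (fun k => (hds k).2.1) hfair
    obtain ⟨-, ⟨ξ, hξ, hn⟩, -⟩ := hd0
    exact hn ((key ξ (hφ ξ hξ) 0).2 (hsat ξ hξ))

end Tableau

/-! ### Words over all variables and their projections -/

section Words

set_option linter.unusedSectionVars false

variable {V : Type*} [Fintype V] [DecidableEq V] {n : ℕ}

theorem cut_congr {X σ τ : Finset V} (h : σ ∩ X = τ ∩ X) : cut X σ = cut X τ :=
  Subtype.ext h

theorem inter_eq_of_subset {X Y σ τ : Finset V} (hXY : X ⊆ Y) (h : σ ∩ Y = τ ∩ Y) :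
    σ ∩ X = τ ∩ X := by
  rw [← Finset.inter_eq_right.2 hXY, ← Finset.inter_assoc, ← Finset.inter_assoc, h]

/-! ### Transition systems reading words over all variables -/

namespace TS

variable {I O : Finset V} {T : Type*}

/-- The state at time `k` when the inputs are taken from the word `σ`. -/
def run (s : TS I O T) (σ : ℕ → Finset V) (k : ℕ) : Option T :=
  s.state (fun m => cut I (σ m)) k

/-- The word `σ` has the output of `s` at time `k`. -/
def Emits (s : TS I O T) (σ : ℕ → Finset V) (k : ℕ) : Prop :=
  ∃ t, s.run σ k = some t ∧ (s.label t).1 = σ k ∩ O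

theorem run_zero (s : TS I O T) (σ : ℕ → Finset V) : s.run σ 0 = some s.start := rfl

theorem run_succ (s : TS I O T) (σ : ℕ → Finset V) (k : ℕ) :
    s.run σ (k + 1) = (s.run σ k).bind fun t => s.step t (cut I (σ k)) := rfl

theorem run_succ_of_eq {s : TS I O T} {σ : ℕ → Finset V} {k : ℕ} {t : T}
    (h : s.run σ k = some t) : s.run σ (k + 1) = s.step t (cut I (σ k)) := by
  rw [run_succ, h]; rfl

theorem state_congr (s : TS I O T) {γ γ' : ℕ → Letter I} {k : ℕ} (h : ∀ m < k, γ m = γ' m) :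
    s.state γ k = s.state γ' k := by
  induction k with
  | zero => rfl
  | succ k ih =>
    simp only [state, ih fun m hm => h m (by omega), h k (by omega)]

theorem run_congr (s : TS I O T) {σ τ : ℕ → Finset V} {k : ℕ}
    (h : ∀ m < k, σ m ∩ I = τ m ∩ I) : s.run σ k = s.run τ k :=
  s.state_congr fun m hm => cut_congr (h m hm)

theorem emits_congr {s : TS I O T} {σ τ : ℕ → Finset V} {k : ℕ} (h : ∀ m ≤ k, σ m = τ m) :
    s.Emits σ k ↔ s.Emits τ k := by
  rw [Emits, Emits, s.run_congr fun m hm => by rw [h m hm.le], h k le_rfl]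

theorem Complete.state_isSome {s : TS I O T} (hs : s.Complete) (γ : ℕ → Letter I) (k : ℕ) :
    ∃ t, s.state γ k = some t := by
  induction k with
  | zero => exact ⟨_, rfl⟩
  | succ k ih =>
    obtain ⟨t, ht⟩ := ih
    simpa [state, ht, Option.isSome_iff_exists] using hs t (γ k)

theorem Complete.exists_run {s : TS I O T} (hs : s.Complete) (σ : ℕ → Finset V) (k : ℕ) :
    ∃ t, s.run σ k = some t :=
  hs.state_isSome _ k

/-- Inputs, outputs and the remaining variables partition `V`, so a letter splits uniquely into its
three parts. This replaces the pairs `γ`, `γ'` of the definitions by single words. -/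
theorem compWith_eq_some_iff (hdisj : Disjoint I O) {s : TS I O T} {γ : ℕ → Letter I}
    {γ' : ℕ → Letter (Finset.univ \ (I ∪ O))} {k : ℕ} {c : Finset V} :
    s.compWith γ γ' k = some c ↔ cut I c = γ k ∧ cut (Finset.univ \ (I ∪ O)) c = γ' k ∧
      ∃ t, s.state γ k = some t ∧ (s.label t).1 = c ∩ O := by
  have hγ := (γ k).2
  have hγ' := (γ' k).2
  simp only [compWith, comp, Option.map_map, Option.map_eq_some_iff, Function.comp]
  constructor
  · rintro ⟨t, ht, rfl⟩
    have hl := (s.label t).2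
    refine ⟨Subtype.ext ?_, Subtype.ext ?_, t, ht, ?_⟩
    · simp only [cut]; ext v
      have := @hγ v; have := @hγ' v; have := @hl v
      have : v ∈ I → v ∉ O := fun h => Finset.disjoint_left.1 hdisj h
      simp only [Finset.mem_inter, Finset.mem_union, Finset.mem_sdiff, Finset.mem_univ] at *
      tauto
    · simp only [cut]; ext v
      have := @hγ v; have := @hγ' v; have := @hl v
      simp only [Finset.mem_inter, Finset.mem_union, Finset.mem_sdiff, Finset.mem_univ] at *
      tauto
    · ext v
      have := @hγ v; have := @hγ' v; have := @hl v
      have : v ∈ I → v ∉ O := fun h => Finset.disjoint_left.1 hdisj h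
      simp only [Finset.mem_inter, Finset.mem_union, Finset.mem_sdiff, Finset.mem_univ] at *
      tauto
  · rintro ⟨h1, h2, t, ht, hl⟩
    refine ⟨t, ht, ?_⟩
    rw [hl, ← h1, ← h2]
    simp only [cut]; ext v
    simp only [Finset.mem_inter, Finset.mem_union, Finset.mem_sdiff, Finset.mem_univ]
    tauto

theorem compWith_cut_iff (hdisj : Disjoint I O) {s : TS I O T} {σ : ℕ → Finset V} {k : ℕ} :
    s.compWith (fun m => cut I (σ m)) (fun m => cut _ (σ m)) k = some (σ k) ↔ s.Emits σ k := by
  simp [compWith_eq_some_iff hdisj, Emits, run]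

/-- Restrictions are compared through computations only; since inputs and outputs are disjoint, the
label can be recovered from the letter. -/
theorem label_eq_of_comp_eq (hdisj : Disjoint I O) {T' : Type*} {s : TS I O T}
    {s' : TS I O T'} {γ : ℕ → Letter I} {k : ℕ} {t : T} {t' : T'}
    (h : ∀ c, s'.comp γ k = some c → s.comp γ k = some c)
    (ht' : s'.state γ k = some t') (ht : s.state γ k = some t) :
    (s'.label t').1 = (s.label t).1 := by
  have h1 : s.comp γ k = some ((γ k).1 ∪ (s'.label t').1) := h _ (by simp [comp, ht'])
  simp only [comp, ht, Option.map_some, Option.some.injEq] at h1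
  have hγ := (γ k).2
  have hl := (s.label t).2
  have hl' := (s'.label t').2
  ext v
  have h2 := congrArg (v ∈ ·) h1
  have := @hγ v; have := @hl v; have := @hl' v
  have : v ∈ I → v ∉ O := fun h => Finset.disjoint_left.1 hdisj h
  simp only [Finset.mem_union, eq_iff_iff] at *
  tauto

/-- Along a word, a simulating system follows the simulated one. -/
theorem SimulatedBy.label_eq {O₁ : Finset V} {T₁ : Type*} {s : TS I O T} {g : TS I O₁ T₁}
    (h : s.SimulatedBy g) {γ : ℕ → Letter I} {k : ℕ} {t : T} (ht : s.state γ k = some t) :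
    ∃ u, g.state γ k = some u ∧ (s.label t).1 ∩ O₁ = (g.label u).1 := by
  obtain ⟨R, h0, hR⟩ := h
  have key : ∀ k t, s.state γ k = some t → ∃ u, g.state γ k = some u ∧ R t u := by
    intro k
    induction k with
    | zero =>
      intro t ht
      obtain rfl : s.start = t := Option.some.inj ht
      exact ⟨_, rfl, h0⟩
    | succ k ih =>
      intro t ht
      obtain ⟨t₀, ht₀, hst⟩ := Option.bind_eq_some_iff.1 ht
      obtain ⟨u₀, hu₀, hr⟩ := ih t₀ ht₀
      obtain ⟨u, hu, hr'⟩ := (hR _ _ hr).2 _ _ hst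
      exact ⟨u, by simp [state, hu₀, hu], hr'⟩
  obtain ⟨u, hu, hr⟩ := key k t ht
  exact ⟨u, hu, (hR _ _ hr).1⟩

/-! ### Renaming of states -/

/-- The transition system with its states renamed along `f`; the map `g` recovers the old
states, and unused new states copy old ones. -/
def rename {T' : Type*} (s : TS I O T) (f : T → T') (g : T' → T) : TS I O T' where
  start := f s.start
  step t e := (s.step (g t) e).map f
  label t := s.label (g t)

section Rename

variable {T' : Type*} {s : TS I O T} {f : T → T'} {g : T' → T}

theorem rename_state (hgf : Function.LeftInverse g f) (γ : ℕ → Letter I) (k : ℕ) :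
    (s.rename f g).state γ k = (s.state γ k).map f := by
  induction k with
  | zero => rfl
  | succ k ih =>
    simp only [state, ih]
    cases s.state γ k with
    | none => rfl
    | some t => simp [rename, hgf t]

theorem rename_comp (hgf : Function.LeftInverse g f) (γ : ℕ → Letter I) :
    (s.rename f g).comp γ = s.comp γ := by
  funext k
  simp only [comp, rename_state hgf, Option.map_map]
  congr 1
  funext t
  simp [rename, hgf t]

theorem rename_emits (hgf : Function.LeftInverse g f) (σ : ℕ → Finset V) (k : ℕ) :
    (s.rename f g).Emits σ k ↔ s.Emits σ k := by
  simp only [Emits, run, rename_state hgf, Option.map_eq_some_iff]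
  constructor
  · rintro ⟨_, ⟨t, ht, rfl⟩, hl⟩
    exact ⟨t, ht, by simpa [rename, hgf t] using hl⟩
  · rintro ⟨t, ht, hl⟩
    exact ⟨f t, ⟨t, ht, rfl⟩, by simpa [rename, hgf t] using hl⟩

theorem Complete.rename (hs : s.Complete) (f : T → T') (g : T' → T) :
    (s.rename f g).Complete := by
  intro t e
  simpa [TS.rename] using hs (g t) e

theorem SimulatedBy.rename (hgf : Function.LeftInverse g f) {O₁ : Finset V} {T₁ T₁' : Type*}
    {s₁ : TS I O₁ T₁} {f₁ : T₁ → T₁'} {g₁ : T₁' → T₁} (hgf₁ : Function.LeftInverse g₁ f₁)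
    (h : s.SimulatedBy s₁) : (s.rename f g).SimulatedBy (s₁.rename f₁ g₁) := by
  obtain ⟨R, h0, hR⟩ := h
  refine ⟨fun t u => R (g t) (g₁ u), by simpa [TS.rename, hgf _, hgf₁ _] using h0, ?_⟩
  intro t u htu
  refine ⟨(hR _ _ htu).1, ?_⟩
  intro e t' ht'
  obtain ⟨t'', ht'', rfl⟩ := Option.map_eq_some_iff.1 ht'
  obtain ⟨u', hu', hr⟩ := (hR _ _ htu).2 e t'' ht''
  exact ⟨f₁ u', by simp [TS.rename, hu'], by simpa [hgf _, hgf₁ _] using hr⟩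

end Rename

end TS

/-! ### Histories on which the other processes keep to their guarantees -/

section Certified

variable {T : Type*} {U : Fin n → Type*}

theorem Architecture.guarOut_subset (A : Architecture V n) (i : Fin n) :
    A.guarOut i ⊆ A.out i := Finset.inter_subset_left

theorem Architecture.inp_subset_allInp (A : Architecture V n) (i : Fin n) :
    A.inp i ⊆ A.allInp := Finset.subset_biUnion_of_mem A.inp (Finset.mem_univ i)

theorem Architecture.disjoint_guarOut (A : Architecture V n) (i : Fin n) :
    Disjoint (A.inp i) (A.guarOut i) :=
  (A.inp_disjoint_out i).mono_right (A.guarOut_subset i)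

/-- At time `k`, the word `σ` has the outputs of the strategy `s` of process `i`, and the other
processes keep to their guarantees. -/
def Keeps (A : Architecture V n) (G : ∀ i, TS (A.inp i) (A.guarOut i) (U i)) (i : Fin n)
    (s : TS (A.inp i) (A.out i) T) (σ : ℕ → Finset V) (k : ℕ) : Prop :=
  s.Emits σ k ∧ ∀ j, j ≠ i → (G j).Emits σ k

/-- The strategy `s` of process `i` keeps to its own certificate, does not get stuck, and has
only computations accepted by `M`, provided the other processes keep to their guarantees. -/
structure Certified (A : Architecture V n) (G : ∀ i, TS (A.inp i) (A.guarOut i) (U i))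
    (M : UCB V) (i : Fin n) (s : TS (A.inp i) (A.out i) T) : Prop where
  agrees : ∀ σ m, (∀ k < m, Keeps A G i s σ k) → ∀ t u, s.run σ m = some t →
    (G i).run σ m = some u → (s.label t).1 ∩ A.guarOut i = ((G i).label u).1
  continues : ∀ σ m, (∀ k ≤ m, Keeps A G i s σ k) → ∃ t, s.run σ (m + 1) = some t
  accepts : ∀ σ ρ, (∀ k, Keeps A G i s σ k) → (∀ k, ρ k ∩ A.vars i = σ k ∩ A.vars i) →
    M.Accepts ρ

variable {A : Architecture V n} {G : ∀ i, TS (A.inp i) (A.guarOut i) (U i)} {i : Fin n}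

theorem Keeps.congr {s : TS (A.inp i) (A.out i) T} {σ τ : ℕ → Finset V} {k : ℕ}
    (h : ∀ m ≤ k, σ m = τ m) (hk : Keeps A G i s σ k) : Keeps A G i s τ k :=
  ⟨(TS.emits_congr h).1 hk.1, fun j hj => (TS.emits_congr h).1 (hk.2 j hj)⟩

theorem Certified.exists_run {M : UCB V} {s : TS (A.inp i) (A.out i) T}
    (h : Certified A G M i s) {σ : ℕ → Finset V} {m : ℕ} (hk : ∀ k < m, Keeps A G i s σ k) :
    ∃ t, s.run σ m = some t := by
  cases m with
  | zero => exact ⟨_, rfl⟩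
  | succ m => exact h.continues σ m fun k hkm => hk k (by omega)

/-- The letter `σ` may occur when the strategy of process `i` is in state `t` and the guarantee
transition systems are in the states `w`. -/
def ValidAt (G : ∀ i, TS (A.inp i) (A.guarOut i) (U i)) (i : Fin n)
    (s : TS (A.inp i) (A.out i) T) (t : T) (w : ∀ k, U k) (σ : Finset V) : Prop :=
  (s.label t).1 = σ ∩ A.out i ∧ ∀ k, k ≠ i → ((G k).label (w k)).1 = σ ∩ A.guarOut k

/-- Replaces a condition on a history by one on the current states and letter, which is what the
constraint system can express. -/
theorem keeps_iff_validAt {s : TS (A.inp i) (A.out i) T} {σ : ℕ → Finset V} {k : ℕ} {t : T}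
    {w : ∀ k, U k} (ht : s.run σ k = some t) (hw : ∀ j, (G j).run σ k = some (w j)) :
    Keeps A G i s σ k ↔ ValidAt G i s t w (σ k) := by
  simp [Keeps, ValidAt, TS.Emits, ht, hw]

/-- Prolongation of a history by a valid letter. -/
theorem exists_prolongation {s : TS (A.inp i) (A.out i) T} {σ : ℕ → Finset V} {m : ℕ} {t : T}
    {w : ∀ k, U k} (hk : ∀ k < m, Keeps A G i s σ k) (ht : s.run σ m = some t)
    (hw : ∀ j, (G j).run σ m = some (w j)) {τ : Finset V} (hτ : ValidAt G i s t w τ) :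
    ∃ σ' : ℕ → Finset V, (∀ k < m, σ' k = σ k) ∧ σ' m = τ ∧ (∀ k < m + 1, Keeps A G i s σ' k) ∧
      s.run σ' m = some t ∧ ∀ j, (G j).run σ' m = some (w j) := by
  -- In a Moore machine the states at time `m` depend only on letters before `m`, so the letter at
  -- `m` can be overwritten freely.
  have hlt : ∀ k < m, Function.update σ m τ k = σ k := fun k hk =>
    Function.update_of_ne (by omega) _ _
  have ht' : s.run (Function.update σ m τ) m = some t := by
    rw [← ht]; exact s.run_congr fun k hk => by rw [hlt k hk]
  have hw' : ∀ j, (G j).run (Function.update σ m τ) m = some (w j) := fun j => by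
    rw [← hw j]; exact (G j).run_congr fun k hk => by rw [hlt k hk]
  refine ⟨Function.update σ m τ, hlt, Function.update_self .., fun k hkm => ?_, ht', hw'⟩
  rcases Nat.lt_succ_iff_lt_or_eq.1 hkm with h | rfl
  · exact (hk k h).congr fun l hl => (hlt l (by omega)).symm
  · rw [keeps_iff_validAt ht' hw', Function.update_self]
    exact hτ

/-- The definition quantifies over all infinite extensions of the history, but outputs up to a time
depend only on letters up to that time, so one extension is enough. -/
theorem validHistory_iff {t : ℕ} {h : Fin t → Finset V} {σ : ℕ → Finset V}
    (hσ : ∀ m : Fin t, σ m = h m) :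
    ValidHistory A G i t h ↔ ∀ j, j ≠ i → ∀ k < t, (G j).Emits σ k := by
  have key : ∀ (j : Fin n) (τ : ℕ → Finset V) (k : ℕ),
      ((G j).comp (fun m => cut (A.inp j) (τ m)) k).map (fun c => c ∩ A.guarOut j) =
        some (τ k ∩ A.guarOut j) ↔ (G j).Emits τ k := by
    intro j τ k
    simp only [TS.comp, Option.map_map, Option.map_eq_some_iff, Function.comp, TS.Emits, TS.run]
    refine exists_congr fun u => and_congr_right fun _ => ?_
    have : (cut (A.inp j) (τ k)).1 ∩ A.guarOut j = ∅ :=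
      Finset.disjoint_iff_inter_eq_empty.1
        ((A.disjoint_guarOut j).mono_left (cut (A.inp j) (τ k)).2)
    rw [Finset.union_inter_distrib_right, this, Finset.empty_union,
      Finset.inter_eq_left.2 ((G j).label u).2]
  constructor
  · intro H j hj k hk
    have := H j hj ⟨k, hk⟩ σ hσ
    rw [← hσ ⟨k, hk⟩] at this
    exact (key j σ k).1 this
  · intro H j hj k τ hτ
    rw [← hτ k]
    refine (key j τ k).2 ((TS.emits_congr fun m hm => ?_).1 (H j hj k k.2))
    have hm' : m < t := lt_of_le_of_lt hm k.2
    exact (hσ ⟨m, hm'⟩).trans (hτ ⟨m, hm'⟩).symm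

end Certified

end Words

/-! ### Evaluation of propositional formulas -/

namespace PropForm

variable {X : Type*} {α : X → Prop}

theorem eval_imp {f g : PropForm X} : (f.imp g).Eval α ↔ (f.Eval α → g.Eval α) := by
  simp only [imp, Eval]; tauto

theorem eval_iff {f g : PropForm X} : (f.iff g).Eval α ↔ (f.Eval α ↔ g.Eval α) := by
  simp only [iff, Eval, eval_imp]; tauto

theorem eval_lit {x : X} {p : Prop} [Decidable p] : (lit x p).Eval α ↔ (α x ↔ p) := by
  unfold lit
  split_ifs with h <;> simp [Eval, h]

theorem eval_all {ι : Type*} {s : Finset ι} {f : ι → PropForm X} :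
    (all s f).Eval α ↔ ∀ x ∈ s, (f x).Eval α := by
  have : ∀ l : List ι, Eval α ((l.map f).foldr PropForm.and PropForm.tru) ↔
      ∀ x ∈ l, (f x).Eval α := by
    intro l
    induction l with
    | nil => simp [Eval]
    | cons a l ih => simp [Eval, ih]
  simpa [all] using this s.toList

theorem eval_any {ι : Type*} {s : Finset ι} {f : ι → PropForm X} :
    (any s f).Eval α ↔ ∃ x ∈ s, (f x).Eval α := by
  have : ∀ l : List ι, Eval α ((l.map f).foldr PropForm.or PropForm.fls) ↔
      ∃ x ∈ l, (f x).Eval α := by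
    intro l
    induction l with
    | nil => simp [Eval]
    | cons a l ih => simp [Eval, ih]
  simpa [any] using this s.toList

open Classical in
/-- The number with the binary digits `a 0, …, a (L - 1)` under the assignment `α`. -/
def bitsVal (α : X → Prop) (a : ℕ → X) : ℕ → ℕ
  | 0 => 0
  | L + 1 => (if α (a L) then 2 ^ L else 0) + bitsVal α a L

theorem bitsVal_lt (a : ℕ → X) (L : ℕ) : bitsVal α a L < 2 ^ L := by
  induction L with
  | zero => simp [bitsVal]
  | succ L ih =>
    simp only [bitsVal, pow_succ]
    split_ifs <;> omega

/-- The comparison is lexicographic from the top digit, which outweighs all lower digits together by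
`bitsVal_lt`. -/
theorem eval_bitsGt {a b : ℕ → X} {L : ℕ} :
    (bitsGt a b L).Eval α ↔ bitsVal α b L < bitsVal α a L := by
  induction L with
  | zero => simp [bitsGt, bitsVal, Eval]
  | succ L ih =>
    have ha := bitsVal_lt (α := α) a L
    have hb := bitsVal_lt (α := α) b L
    simp only [bitsGt, Eval, eval_iff, ih, bitsVal]
    by_cases h1 : α (a L) <;> by_cases h2 : α (b L) <;> simp [h1, h2] <;> omega

theorem eval_bitsGe {a b : ℕ → X} {L : ℕ} :
    (bitsGe a b L).Eval α ↔ bitsVal α b L ≤ bitsVal α a L := by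
  simp [bitsGe, Eval, eval_bitsGt]

theorem bitsVal_eq {a : ℕ → X} {N L : ℕ} (h : ∀ d, α (a d) ↔ N.testBit d) (hN : N < 2 ^ L) :
    bitsVal α a L = N := by
  have key : ∀ L, bitsVal α a L = N % 2 ^ L := by
    intro L
    induction L with
    | zero => simp [bitsVal, Nat.mod_one]
    | succ L ih =>
      rw [Nat.mod_pow_succ, ← ih, bitsVal, ← Nat.toNat_testBit]
      by_cases hb : N.testBit L <;> simp [h, hb, add_comm]
  rw [key, Nat.mod_eq_of_lt hN]

end PropForm

/-! ### Finite graphs -/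

/-- A node that is reachable and lies on a cycle is visited infinitely often by some path. -/
theorem exists_path_frequently {X : Type*} {r : X → X → Prop} {a b : X}
    (hab : Relation.ReflTransGen r a b) (hbb : Relation.TransGen r b b) :
    ∃ f : ℕ → X, f 0 = a ∧ (∀ k, r (f k) (f (k + 1))) ∧ ∀ k, ∃ j ≥ k, f j = b := by
  classical
  have htg : ∀ x, Relation.ReflTransGen r x b → Relation.TransGen r x b := fun x hx =>
    Relation.TransGen.trans_right hx hbb
  -- a distance to `b`, at least one
  have hdist : ∀ x, Relation.TransGen r x b →
      ∃ d, ∃ p : ℕ → X, p 0 = x ∧ p (d + 1) = b ∧ ∀ k ≤ d, r (p k) (p (k + 1)) := by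
    intro x hx
    induction hx using Relation.TransGen.head_induction_on with
    | @single x h => exact ⟨0, fun k => if k = 0 then x else b, rfl, rfl, by simpa using h⟩
    | @head x y h _ ih =>
      obtain ⟨d, p, h0, h1, h2⟩ := ih
      refine ⟨d + 1, fun k => Nat.casesOn k x p, rfl, h1, ?_⟩
      intro k hk
      cases k with
      | zero => simpa [h0] using h
      | succ k => exact h2 k (by omega)
  let D : X → ℕ → Prop := fun x d =>
    ∃ p : ℕ → X, p 0 = x ∧ p (d + 1) = b ∧ ∀ k ≤ d, r (p k) (p (k + 1))
  -- `D x d` records a path of `d + 1` edges from `x` to `b`. Follow it, and on arrival at `b` start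
  -- again with a path from `b` back to itself.
  have hstep : ∀ q : {q : X × ℕ // D q.1 q.2}, ∃ q' : {q : X × ℕ // D q.1 q.2},
      r q.1.1 q'.1.1 ∧ (q.1.2 = 0 → q'.1.1 = b) ∧ (q.1.2 ≠ 0 → q'.1.2 < q.1.2) := by
    rintro ⟨⟨x, d⟩, p, h0, h1, h2⟩
    cases d with
    | zero =>
      obtain ⟨d, hd⟩ := hdist b hbb
      refine ⟨⟨(b, d), hd⟩, ?_, fun _ => rfl, fun h => absurd rfl h⟩
      have := h2 0 le_rfl
      rwa [h0, h1] at this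
    | succ d =>
      refine ⟨⟨(p 1, d), fun k => p (k + 1), rfl, h1, fun k hk => h2 (k + 1) (by omega)⟩, ?_,
        fun h => absurd h (Nat.succ_ne_zero d), fun _ => Nat.lt_succ_self d⟩
      have := h2 0 (Nat.zero_le _)
      rwa [h0] at this
  choose nxt hn1 hn2 hn3 using hstep
  obtain ⟨d₀, hd₀⟩ := hdist a (htg a hab)
  let F : ℕ → {q : X × ℕ // D q.1 q.2} := fun k => nxt^[k] ⟨(a, d₀), hd₀⟩
  have hF : ∀ k, F (k + 1) = nxt (F k) := fun k => Function.iterate_succ_apply' _ _ _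
  refine ⟨fun k => (F k).1.1, rfl, fun k => by simpa only [hF] using hn1 (F k), fun k => ?_⟩
  induction hd : (F k).1.2 using Nat.strong_induction_on generalizing k with
  | _ d ih =>
    by_cases h0 : (F k).1.2 = 0
    · exact ⟨k + 1, by omega, by simpa only [hF] using hn2 (F k) h0⟩
    · have hlt := hn3 (F k) h0
      rw [← hF] at hlt
      obtain ⟨j, hj, hb⟩ := ih _ (hd ▸ hlt) (k + 1) rfl
      exact ⟨j, by omega, hb⟩

/-- A bounded monotone sequence increases only finitely often. -/
theorem finite_of_bounded_increase {f : ℕ → ℕ} {N : ℕ} {P : ℕ → Prop} (hN : ∀ k, f k < N)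
    (hmono : ∀ k, f k ≤ f (k + 1)) (hP : ∀ k, P (k + 1) → f k < f (k + 1)) :
    {k | P k}.Finite := by
  have hm : Monotone f := monotone_nat_of_le_succ hmono
  -- The values `f (k + 1)` at these indices are pairwise distinct and below `N`. Index `0` has no
  -- predecessor and is added separately.
  have hfin : {k | P (k + 1)}.Finite := by
    refine Set.Finite.of_finite_image ((Set.finite_lt_nat N).subset
      (Set.image_subset_iff.2 (fun k _ => hN (k + 1)))) (f := fun k => f (k + 1)) ?_
    intro k hk l hl hkl
    have aux : ∀ k l, P (l + 1) → k < l → f (k + 1) < f (l + 1) := fun k l hl h =>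
      (hm (by omega)).trans_lt (hP l hl)
    rcases lt_trichotomy k l with h | h | h
    · exact absurd hkl (aux k l hl h).ne
    · exact h
    · exact absurd hkl.symm (aux l k hk h).ne
  refine ((hfin.image (· + 1)).insert 0).subset ?_
  intro k hk
  cases k with
  | zero => exact Set.mem_insert _ _
  | succ k => exact Set.mem_insert_of_mem _ ⟨k, hk, rfl⟩

/-! ### The meaning of the constraint system -/

section Meaning

set_option linter.unusedSectionVars false

variable {V : Type*} [Fintype V] [DecidableEq V] {n : ℕ} {A : Architecture V n}
  {M : Fin n → UCB V} {B : Bounds n} {α : CVar A M B → Prop}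
  {S : ∀ i, TS (A.inp i) (A.out i) (B.S i)} {G : ∀ i, TS (A.inp i) (A.guarOut i) (B.G i)}

open PropForm

/-- The letter `σ` leads from `(t, w)` to `(t', w')`. -/
def Leads {T : Type*} {U : Fin n → Type*} (G : ∀ i, TS (A.inp i) (A.guarOut i) (U i)) (i : Fin n)
    (s : TS (A.inp i) (A.out i) T) (t : T) (w : ∀ k, U k) (σ : Finset V) (t' : T)
    (w' : ∀ k, U k) : Prop :=
  s.step t (cut (A.inp i) σ) = some t' ∧ ∀ k, (G k).step (w k) (cut (A.inp k) σ) = some (w' k)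

theorem eq_inter_iff_forall_mem {X Y σ : Finset V} (h : Y ⊆ X) :
    Y = σ ∩ X ↔ ∀ v ∈ X, v ∈ Y ↔ v ∈ σ := by
  constructor
  · rintro rfl v hv
    simp [hv]
  · intro H
    ext v
    rw [Finset.mem_inter]
    exact ⟨fun hv => ⟨(H v (h hv)).1 hv, h hv⟩, fun hv => (H v hv.2).2 hv.1⟩

theorem Describes.eval_validLetter (hd : Describes α S G) {i : Fin n} {t : B.S i}
    {w : ∀ k, B.G k} {σ : Finset V} :
    (validLetter A M B i t w σ).Eval α ↔ ValidAt G i (S i) t w σ := by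
  simp only [validLetter, Eval, eval_all, eval_lit, ValidAt, Finset.mem_erase, Finset.mem_univ,
    and_true]
  refine and_congr ?_ (forall_congr' fun k => imp_congr_right fun _ => ?_)
  · rw [eq_inter_iff_forall_mem ((S i).label t).2]
    exact forall₂_congr fun v hv => by rw [(hd i).1.2.2 t v hv]
  · rw [eq_inter_iff_forall_mem ((G k).label (w k)).2]
    exact forall₂_congr fun v hv => by rw [(hd k).2.2.2 (w k) v hv]

theorem Describes.eval_jointStep (hd : Describes α S G) {i : Fin n} {t t' : B.S i}
    {w w' : ∀ k, B.G k} {σ : Finset V} :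
    (jointStep A M B i t w σ t' w').Eval α ↔ Leads G i (S i) t w σ t' w' := by
  simp only [jointStep, Eval, eval_all, Leads, Finset.mem_univ, true_imp_iff]
  refine and_congr ((hd i).1.2.1 _ _ _) (forall_congr' fun k => (hd k).2.2.1 _ _ _)

/-- The determinism clause disappears, because `step` is already a function. -/
theorem Describes.eval_guarComplete (hd : Describes α S G) {i : Fin n} :
    (guarComplete A M B i).Eval α ↔ (G i).Complete := by
  simp only [guarComplete, Eval, eval_all, eval_any, Finset.mem_univ, true_imp_iff, true_and,
    Finset.mem_erase, and_true, (hd i).2.2.1, TS.Complete, Option.isSome_iff_exists]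
  refine forall₂_congr fun u e => and_iff_left ?_
  intro u' u'' hne
  by_contra h
  push Not at h
  exact hne (Option.some.inj (h.2.symm.trans h.1))

theorem Describes.eval_ownCertificate (hd : Describes α S G) {i : Fin n} :
    (ownCertificate A M B i).Eval α ↔ ∀ t w, α (.joint i t w) →
      ((S i).label t).1 ∩ A.guarOut i = ((G i).label (w i)).1 := by
  simp only [ownCertificate, Eval, eval_all, eval_imp, eval_iff, Finset.mem_univ, true_imp_iff]
  refine forall₂_congr fun t w => imp_congr_right fun _ => ?_
  rw [eq_comm, eq_inter_iff_forall_mem ((G i).label (w i)).2]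
  refine forall₂_congr fun v hv => ?_
  rw [(hd i).1.2.2 t v (A.guarOut_subset i hv), (hd i).2.2.2 (w i) v hv]
  exact iff_comm

theorem Describes.eval_jointBehavior (hd : Describes α S G) {i : Fin n} :
    (jointBehavior A M B i).Eval α ↔ α (.joint i (B.s0 i) B.g0) ∧
      ∀ t w, α (.joint i t w) → ∀ σ, ValidAt G i (S i) t w σ → ∀ t' w',
        Leads G i (S i) t w σ t' w' → α (.joint i t' w') := by
  simp only [jointBehavior, Eval, eval_all, eval_imp, Finset.mem_univ, true_imp_iff,
    hd.eval_validLetter, hd.eval_jointStep]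

theorem Describes.eval_stratTransitions (hd : Describes α S G) {i : Fin n} :
    (stratTransitions A M B i).Eval α ↔
      ∀ t w, α (.joint i t w) → ∀ σ, ValidAt G i (S i) t w σ →
        ∃ t', (S i).step t (cut (A.inp i) σ) = some t' := by
  simp only [stratTransitions, Eval, eval_all, eval_any, eval_imp, Finset.mem_univ, true_imp_iff,
    true_and, Finset.mem_erase, and_true, hd.eval_validLetter, (hd i).1.2.1]
  refine and_iff_left ?_
  intro t e t' t'' hne
  by_contra h
  push Not at h
  exact hne (Option.some.inj (h.2.symm.trans h.1))

theorem eval_boundStep {i : Fin n} {t t' : B.S i} {w w' : ∀ k, B.G k}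
    {q q' : Fin (M i).size} :
    (boundStep A M B i t w q t' w' q').Eval α ↔
      bitsVal α (CVar.bit i t w q) (numBits M B i) ≤
          bitsVal α (CVar.bit i t' w' q') (numBits M B i) ∧
        (q' ∈ (M i).rejecting → bitsVal α (CVar.bit i t w q) (numBits M B i) <
          bitsVal α (CVar.bit i t' w' q') (numBits M B i)) := by
  unfold boundStep
  split_ifs with h
  · simp only [eval_bitsGt, h, true_imp_iff]
    exact ⟨fun h => ⟨h.le, h⟩, fun h => h.2⟩
  · simp [eval_bitsGe, h]

theorem Describes.eval_validAnnotation (hd : Describes α S G) {i : Fin n} :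
    (validAnnotation A M B i).Eval α ↔ α (.reach i (B.s0 i) B.g0 (M i).start) ∧
      ∀ t w q, α (.reach i t w q) → ∀ σ, ValidAt G i (S i) t w σ → ∀ t' w',
        Leads G i (S i) t w σ t' w' → ∀ ρ : Finset V, ρ ∩ A.vars i = σ ∩ A.vars i →
          ∀ q' ∈ (M i).delta q ρ, α (.reach i t' w' q') ∧
            (bitsVal α (CVar.bit i t w q) (numBits M B i) ≤
              bitsVal α (CVar.bit i t' w' q') (numBits M B i) ∧
            (q' ∈ (M i).rejecting → bitsVal α (CVar.bit i t w q) (numBits M B i) <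
              bitsVal α (CVar.bit i t' w' q') (numBits M B i))) := by
  simp only [validAnnotation, Eval, eval_all, eval_imp, Finset.mem_univ, true_imp_iff,
    hd.eval_validLetter, hd.eval_jointStep, Finset.mem_filter, true_and, eval_boundStep]

theorem Leads.run_succ {T : Type*} {U : Fin n → Type*}
    {G : ∀ i, TS (A.inp i) (A.guarOut i) (U i)} {i : Fin n} {s : TS (A.inp i) (A.out i) T}
    {σ : ℕ → Finset V} {m : ℕ} {t t' : T} {w w' : ∀ k, U k}
    (h : Leads G i s t w (σ m) t' w') (ht : s.run σ m = some t)
    (hw : ∀ k, (G k).run σ m = some (w k)) :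
    s.run σ (m + 1) = some t' ∧ ∀ k, (G k).run σ (m + 1) = some (w' k) :=
  ⟨(TS.run_succ_of_eq ht).trans h.1, fun k => (TS.run_succ_of_eq (hw k)).trans (h.2 k)⟩

/-! ### From satisfying assignments to certified systems -/

/-- The systems described by a solution of the constraint system are certified. -/
theorem certified_of_eval (hd : Describes α S G) (he : (constraintSystem A M B).Eval α) :
    (∀ i, (G i).Complete) ∧ ∀ i, Certified A G (M i) i (S i) := by
  simp only [constraintSystem, eval_all, Finset.mem_univ, true_imp_iff, Eval,
    hd.eval_guarComplete, hd.eval_ownCertificate, hd.eval_jointBehavior, hd.eval_stratTransitions,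
    hd.eval_validAnnotation] at he
  have hG : ∀ i, (G i).Complete := fun i => (he i).1
  refine ⟨hG, fun i => ?_⟩
  obtain ⟨-, hb, ⟨hc0, hc⟩, hdd, he0, he⟩ := he i
  have hstep : ∀ σ m t w, Keeps A G i (S i) σ m → (S i).run σ m = some t →
      (∀ k, (G k).run σ m = some (w k)) → α (.joint i t w) →
      ValidAt G i (S i) t w (σ m) ∧ ∃ t' w', Leads G i (S i) t w (σ m) t' w' := by
    intro σ m t w hk ht hw hj
    have hv := (keeps_iff_validAt ht hw).1 hk
    obtain ⟨t', ht'⟩ := hdd t w hj (σ m) hv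
    choose w' hw' using fun k => Option.isSome_iff_exists.1 (hG k (w k) (cut (A.inp k) (σ m)))
    exact ⟨hv, t', w', ht', hw'⟩
  -- Along a history on which all keep to their guarantees, (d) supplies the next strategy state,
  -- (a) the next guarantee states, and (c) keeps the pair in `joint`.
  have hjoint : ∀ σ m, (∀ k < m, Keeps A G i (S i) σ k) → ∃ t w, (S i).run σ m = some t ∧
      (∀ k, (G k).run σ m = some (w k)) ∧ α (.joint i t w) := by
    intro σ m
    induction m with
    | zero =>
      intro _
      exact ⟨B.s0 i, B.g0, by rw [TS.run_zero, (hd i).1.1],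
        fun k => by rw [TS.run_zero, (hd k).2.1], hc0⟩
    | succ m ih =>
      intro hk
      obtain ⟨t, w, ht, hw, hj⟩ := ih fun k hkm => hk k (by omega)
      obtain ⟨hv, t', w', hl⟩ := hstep σ m t w (hk m (by omega)) ht hw hj
      obtain ⟨h1, h2⟩ := hl.run_succ ht hw
      exact ⟨t', w', h1, h2, hc t w hj _ hv t' w' hl⟩
  refine ⟨?_, ?_, ?_⟩
  · intro σ m hk t u ht hu
    obtain ⟨t', w, ht', hw, hj⟩ := hjoint σ m hk
    obtain rfl := Option.some.inj (ht'.symm.trans ht)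
    obtain rfl := Option.some.inj ((hw i).symm.trans hu)
    exact hb _ _ hj
  · intro σ m hk
    obtain ⟨t, w, ht, -⟩ := hjoint σ (m + 1) fun k hkm => hk k (by omega)
    exact ⟨t, ht⟩
  · intro σ ρ hk hρ r hr0 hr
    choose t w ht hw hj using fun m => hjoint σ m fun k _ => hk k
    have hlead : ∀ m, ValidAt G i (S i) (t m) (w m) (σ m) ∧
        Leads G i (S i) (t m) (w m) (σ m) (t (m + 1)) (w (m + 1)) := by
      intro m
      obtain ⟨hv, t', w', hl⟩ := hstep σ m _ _ (hk m) (ht m) (hw m) (hj m)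
      obtain ⟨h1, h2⟩ := hl.run_succ (ht m) (hw m)
      obtain rfl := Option.some.inj (h1.symm.trans (ht (m + 1)))
      obtain rfl : w' = w (m + 1) :=
        funext fun k => Option.some.inj ((h2 k).symm.trans (hw (m + 1) k))
      exact ⟨hv, hl⟩
    have hreach : ∀ m, α (.reach i (t m) (w m) (r m)) := by
      intro m
      induction m with
      | zero =>
        have h1 : t 0 = B.s0 i := by
          have := ht 0
          rw [TS.run_zero, (hd i).1.1] at this
          exact (Option.some.inj this).symm
        have h2 : w 0 = B.g0 := by
          funext k
          have := hw 0 k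
          rw [TS.run_zero, (hd k).2.1] at this
          exact (Option.some.inj this).symm
        rw [h1, h2, hr0]
        exact he0
      | succ m ih =>
        exact (he _ _ _ ih _ (hlead m).1 _ _ (hlead m).2 (ρ m) (hρ m) _ (hr m)).1
    have hval := fun m =>
      (he _ _ _ (hreach m) _ (hlead m).1 _ _ (hlead m).2 (ρ m) (hρ m) _ (hr m)).2
    -- The annotation along the run is bounded by the number of digits, never decreases, and grows
    -- at each rejecting state that is entered.
    exact finite_of_bounded_increase
      (f := fun m => bitsVal α (CVar.bit i (t m) (w m) (r m)) (numBits M B i))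
      (fun m => bitsVal_lt _ _) (fun m => (hval m).1) (fun m => (hval m).2)

/-! ### From certified systems to satisfying assignments -/

/-- Reachability of `(t, w)` by a history on which the other processes keep to their
guarantees. -/
def JointlyReachable {T : Type*} {U : Fin n → Type*} (G : ∀ i, TS (A.inp i) (A.guarOut i) (U i))
    (i : Fin n) (s : TS (A.inp i) (A.out i) T) (t : T) (w : ∀ k, U k) : Prop :=
  ∃ m σ, (∀ k < m, Keeps A G i s σ k) ∧ s.run σ m = some t ∧ ∀ k, (G k).run σ m = some (w k)

/-- The edges of the run graph of the automaton `N` on the computations of `s`. -/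
def RunEdge {T : Type*} {U : Fin n → Type*} (G : ∀ i, TS (A.inp i) (A.guarOut i) (U i))
    (N : UCB V) (i : Fin n) (s : TS (A.inp i) (A.out i) T)
    (x y : T × (∀ k, U k) × Fin N.size) : Prop :=
  ∃ σ ρ : Finset V, ValidAt G i s x.1 x.2.1 σ ∧ Leads G i s x.1 x.2.1 σ y.1 y.2.1 ∧
    ρ ∩ A.vars i = σ ∩ A.vars i ∧ y.2.2 ∈ N.delta x.2.2 ρ

/-- No cycle of the reachable run graph of a certified strategy has a rejecting node. -/
theorem Certified.not_transGen {T : Type*} {U : Fin n → Type*}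
    {G : ∀ i, TS (A.inp i) (A.guarOut i) (U i)} {N : UCB V} {i : Fin n}
    {s : TS (A.inp i) (A.out i) T} (hs : Certified A G N i s)
    {x : T × (∀ k, U k) × Fin N.size}
    (hx : Relation.ReflTransGen (RunEdge G N i s) (s.start, fun k => (G k).start, N.start) x)
    (hrej : x.2.2 ∈ N.rejecting) : ¬ Relation.TransGen (RunEdge G N i s) x x := by
  intro hcyc
  -- The cycle unrolls to an infinite path. Its letters `σ` form a word on which all guarantees are
  -- kept, and its letters `ρ` a word with a run of `N` that is rejecting infinitely often, contrary
  -- to `accepts`.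
  obtain ⟨f, hf0, hf, hfr⟩ := exists_path_frequently hx hcyc
  choose σ ρ hv hl hρ hδ using hf
  have hrun : ∀ m, s.run σ m = some (f m).1 ∧ ∀ k, (G k).run σ m = some ((f m).2.1 k) := by
    intro m
    induction m with
    | zero => rw [hf0]; exact ⟨rfl, fun k => rfl⟩
    | succ m ih => exact (hl m).run_succ ih.1 ih.2
  have hfin := hs.accepts σ ρ (fun k => (keeps_iff_validAt (hrun k).1 (hrun k).2).2 (hv k)) hρ
    (fun k => (f k).2.2) (by rw [hf0]) hδ
  obtain ⟨K, hK⟩ := hfin.bddAbove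
  obtain ⟨j, hj, hjx⟩ := hfr (K + 1)
  have : j ≤ K := hK (by rw [Set.mem_ofPred_eq, hjx]; exact hrej)
  omega

/-- The number of rejecting nodes of the reachable run graph from which the node can be
reached. -/
def rejectingRank {T : Type*} {U : Fin n → Type*} (G : ∀ i, TS (A.inp i) (A.guarOut i) (U i))
    (N : UCB V) (i : Fin n) (s : TS (A.inp i) (A.out i) T)
    (x : T × (∀ k, U k) × Fin N.size) : ℕ :=
  Set.ncard {y | y.2.2 ∈ N.rejecting ∧
    Relation.ReflTransGen (RunEdge G N i s) (s.start, fun k => (G k).start, N.start) y ∧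
    Relation.ReflTransGen (RunEdge G N i s) y x}

/-- Certified systems are described by a solution of the constraint system. -/
theorem exists_eval_of_certified (h0 : ∀ i, (S i).start = B.s0 i ∧ (G i).start = B.g0 i)
    (hG : ∀ i, (G i).Complete) (hS : ∀ i, Certified A G (M i) i (S i)) :
    ∃ α : CVar A M B → Prop, (constraintSystem A M B).Eval α ∧ Describes α S G := by
  let α : CVar A M B → Prop := fun x => match x with
    | .trans i t e t' => (S i).step t e = some t'
    | .label i t v => v ∈ ((S i).label t).1
    | .gtrans i u e u' => (G i).step u e = some u'
    | .glabel i u v => v ∈ ((G i).label u).1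
    | .joint i t w => JointlyReachable G i (S i) t w
    | .reach i t w q => Relation.ReflTransGen (RunEdge G (M i) i (S i))
        ((S i).start, fun k => (G k).start, (M i).start) (t, w, q)
    | .bit i t w q d => (rejectingRank G (M i) i (S i) (t, w, q)).testBit d
  have hd : Describes α S G := fun i =>
    ⟨⟨(h0 i).1, fun _ _ _ => Iff.rfl, fun _ _ _ => Iff.rfl⟩,
      ⟨(h0 i).2, fun _ _ _ => Iff.rfl, fun _ _ _ => Iff.rfl⟩⟩
  refine ⟨α, ?_, hd⟩
  simp only [constraintSystem, eval_all, Finset.mem_univ, true_imp_iff, Eval,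
    hd.eval_guarComplete, hd.eval_ownCertificate, hd.eval_jointBehavior, hd.eval_stratTransitions,
    hd.eval_validAnnotation]
  intro i
  have hg0 : (fun k => (G k).start) = B.g0 := funext fun k => (h0 k).2
  have hval : ∀ t w q, bitsVal α (CVar.bit i t w q) (numBits M B i) =
      rejectingRank G (M i) i (S i) (t, w, q) := by
    intro t w q
    -- The rank is at most the number of all nodes, which `numBits` digits can represent.
    refine bitsVal_eq (fun d => Iff.rfl) (lt_of_le_of_lt ?_ (Nat.lt_size_self _))
    refine (Set.ncard_le_card _).trans ?_
    simp [Nat.card_eq_fintype_card, mul_assoc]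
  refine ⟨hG i, ?_, ⟨?_, ?_⟩, ?_, ?_, ?_⟩
  · rintro t w ⟨m, σ, hk, ht, hw⟩
    exact (hS i).agrees σ m hk t (w i) ht (hw i)
  · exact ⟨0, fun _ => ∅, by simp, by rw [TS.run_zero, (h0 i).1],
      fun k => by rw [TS.run_zero, (h0 k).2]⟩
  · rintro t w ⟨m, σ, hk, ht, hw⟩ τ hτ t' w' hl
    obtain ⟨σ', -, rfl, hk', ht', hw'⟩ := exists_prolongation hk ht hw hτ
    exact ⟨m + 1, σ', hk', hl.run_succ ht' hw'⟩
  · rintro t w ⟨m, σ, hk, ht, hw⟩ τ hτ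
    obtain ⟨σ', -, rfl, hk', ht', hw'⟩ := exists_prolongation hk ht hw hτ
    obtain ⟨t', h⟩ := (hS i).continues σ' m fun k hkm => hk' k (by omega)
    exact ⟨t', (TS.run_succ_of_eq ht').symm.trans h⟩
  · change Relation.ReflTransGen _ _ _
    rw [(h0 i).1, hg0]
  · intro t w q hr σ hv t' w' hl ρ hρ q' hq'
    rw [hval, hval]
    have hedge : RunEdge G (M i) i (S i) (t, w, q) (t', w', q') := ⟨σ, ρ, hv, hl, hρ, hq'⟩
    have hr' : Relation.ReflTransGen (RunEdge G (M i) i (S i))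
      ((S i).start, fun k => (G k).start, (M i).start) (t', w', q') := hr.tail hedge
    have hsub : {y | y.2.2 ∈ (M i).rejecting ∧ Relation.ReflTransGen (RunEdge G (M i) i (S i))
          ((S i).start, fun k => (G k).start, (M i).start) y ∧
          Relation.ReflTransGen (RunEdge G (M i) i (S i)) y (t, w, q)} ⊆
        {y | y.2.2 ∈ (M i).rejecting ∧ Relation.ReflTransGen (RunEdge G (M i) i (S i))
          ((S i).start, fun k => (G k).start, (M i).start) y ∧
          Relation.ReflTransGen (RunEdge G (M i) i (S i)) y (t', w', q')} :=
      fun y hy => ⟨hy.1, hy.2.1, hy.2.2.tail hedge⟩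
    refine ⟨hr', Set.ncard_le_ncard hsub, fun hrej => Set.ncard_lt_ncard ?_⟩
    -- The new rejecting node counts itself. Had it been counted for the old node, the edge would
    -- close a cycle through it.
    refine (Set.ssubset_iff_of_subset hsub).2 ⟨(t', w', q'), ⟨hrej, hr', .refl⟩, ?_⟩
    rintro ⟨-, -, hback⟩
    exact (hS i).not_transGen hr' hrej (Relation.TransGen.tail' hback hedge)

/-- A solution of the constraint system describes transition systems. -/
theorem exists_describes (he : (constraintSystem A M B).Eval α) : ∃ S G, Describes α S G := by
  classical
  simp only [constraintSystem, eval_all, Finset.mem_univ, true_imp_iff, Eval, guarComplete,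
    stratTransitions, eval_any, Finset.mem_erase, and_true] at he
  have hs : ∀ i t e t' t'', α (.trans i t e t') → α (.trans i t e t'') → t'' = t' := by
    intro i t e t' t'' h h'
    by_contra hne
    exact ((he i).2.2.2.1.2 t e t' t'' hne).elim (· h) (· h')
  have hg : ∀ i u e u' u'', α (.gtrans i u e u') → α (.gtrans i u e u'') → u'' = u' := by
    intro i t e t' t'' h h'
    by_contra hne
    exact (((he i).1 t e).2 t' t'' hne).elim (· h) (· h')
  -- By determinism the chosen successor is the only one. Labels are cut down to the process's own
  -- outputs, since other label variables do not occur in the constraints.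
  refine ⟨fun i => ⟨B.s0 i, fun t e => if h : ∃ t', α (.trans i t e t') then some h.choose
      else none, fun t => ⟨(A.out i).filter fun v => α (.label i t v),
        Finset.filter_subset _ _⟩⟩,
    fun i => ⟨B.g0 i, fun t e => if h : ∃ t', α (.gtrans i t e t') then some h.choose
      else none, fun t => ⟨(A.guarOut i).filter fun v => α (.glabel i t v),
        Finset.filter_subset _ _⟩⟩, fun i => ⟨⟨rfl, ?_, ?_⟩, ⟨rfl, ?_, ?_⟩⟩⟩
  · intro t e t'
    dsimp only
    constructor
    · intro h
      have hx : ∃ t', α (.trans i t e t') := ⟨t', h⟩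
      rw [dif_pos hx]
      exact congrArg some (hs i t e _ _ h hx.choose_spec)
    · intro h
      split_ifs at h with hx
      rw [← Option.some.inj h]
      exact hx.choose_spec
  · intro t v hv
    simp [hv]
  · intro t e t'
    dsimp only
    constructor
    · intro h
      have hx : ∃ t', α (.gtrans i t e t') := ⟨t', h⟩
      rw [dif_pos hx]
      exact congrArg some (hg i t e _ _ h hx.choose_spec)
    · intro h
      split_ifs at h with hx
      rw [← Option.some.inj h]
      exact hx.choose_spec
  · intro t v hv
    simp [hv]

end Meaning

/-! ### Compactness of the space of words -/

/-- A family of conditions on longer and longer prefixes of words over a finite alphabet, each of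
them satisfiable, is satisfied by an infinite word. -/
theorem exists_word_of_prefixes {X : Type*} [Finite X] {P : ℕ → (ℕ → X) → Prop}
    (hP : ∀ m σ τ, (∀ k < m, σ k = τ k) → P m σ → P m τ) (hmono : ∀ m σ, P (m + 1) σ → P m σ)
    (hne : ∀ m, ∃ σ, P m σ) : ∃ σ, ∀ m, P m σ := by
  -- With the finite discrete alphabet, the product space of words is compact, and a condition on a
  -- finite prefix defines a closed set. A decreasing sequence of nonempty such sets has a common
  -- point.
  let _ : TopologicalSpace X := ⊥
  have _ : DiscreteTopology X := ⟨rfl⟩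
  have hcl : ∀ m, IsClosed {σ | P m σ} := by
    intro m
    have : {σ | P m σ} = (fun (σ : ℕ → X) (k : Fin m) => σ k) ⁻¹'
        {p | ∃ σ, P m σ ∧ ∀ k : Fin m, σ k = p k} := by
      ext σ
      exact ⟨fun h => ⟨σ, h, fun _ => rfl⟩,
        fun ⟨τ, h, hτ⟩ => hP m τ σ (fun k hk => hτ ⟨k, hk⟩) h⟩
    rw [this]
    exact (isClosed_discrete _).preimage (by fun_prop)
  obtain ⟨σ, hσ⟩ := IsCompact.nonempty_iInter_of_sequence_nonempty_isCompact_isClosed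
    (fun m => {σ | P m σ}) hmono hne (hcl 0).isCompact hcl
  exact ⟨σ, fun m => Set.mem_iInter.1 hσ m⟩

/-! ### Restriction to local strategies -/

section Restriction

set_option linter.unusedSectionVars false

variable {V : Type*} [Fintype V] [DecidableEq V] {n : ℕ} {A : Architecture V n} {T : Type*}
  {U : Fin n → Type*} {G : ∀ i, TS (A.inp i) (A.guarOut i) (U i)} {i : Fin n}

/-- The states of the guarantee transition systems that are possible after the input `e`, if
those in `K` were possible before. -/
def successors (G : ∀ i, TS (A.inp i) (A.guarOut i) (U i)) (i : Fin n)
    (s : TS (A.inp i) (A.out i) T) (t : T) (K : Set (∀ k, U k)) (e : Letter (A.inp i)) :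
    Set (∀ k, U k) :=
  {w' | ∃ w ∈ K, ∃ σ, ValidAt G i s t w σ ∧ cut (A.inp i) σ = e ∧
    ∀ k, (G k).step (w k) (cut (A.inp k) σ) = some (w' k)}

open Classical in
/-- The strategy `s` together with the set of possible states of the guarantee transition
systems; it stops as soon as there are none. -/
def restrict (G : ∀ i, TS (A.inp i) (A.guarOut i) (U i)) (i : Fin n)
    (s : TS (A.inp i) (A.out i) T) : TS (A.inp i) (A.out i) (T × Set (∀ k, U k)) where
  start := (s.start, {fun k => (G k).start})
  step x e := if (successors G i s x.1 x.2 e).Nonempty then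
      (s.step x.1 e).map fun t' => (t', successors G i s x.1 x.2 e)
    else none
  label x := s.label x.1

/-- The states of the guarantee transition systems that are possible at time `m` for the
inputs `γ`. -/
def possible (G : ∀ i, TS (A.inp i) (A.guarOut i) (U i)) (i : Fin n)
    (s : TS (A.inp i) (A.out i) T) (γ : ℕ → Letter (A.inp i)) (m : ℕ) : Set (∀ k, U k) :=
  {w | ∃ σ, (∀ k < m, cut (A.inp i) (σ k) = γ k ∧ Keeps A G i s σ k) ∧
    ∀ k, (G k).run σ m = some (w k)}

/-- Correctness of the subset construction: updating the set letter by letter agrees with the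
definition by whole histories, because the state of `s` is determined by `γ` alone. -/
theorem successors_possible {s : TS (A.inp i) (A.out i) T} {γ : ℕ → Letter (A.inp i)} {m : ℕ}
    {t : T} (ht : s.state γ m = some t) :
    successors G i s t (possible G i s γ m) (γ m) = possible G i s γ (m + 1) := by
  have hrun : ∀ σ : ℕ → Finset V, (∀ k < m, cut (A.inp i) (σ k) = γ k) →
      s.run σ m = some t := fun σ hσ => (s.state_congr hσ).trans ht
  ext w'
  constructor
  · rintro ⟨w, ⟨σ, hσ, hw⟩, τ, hv, hτ, hstep⟩
    obtain ⟨σ', hσ', rfl, hk, -, hw'⟩ := exists_prolongation (fun k hk => (hσ k hk).2)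
      (hrun σ fun k hk => (hσ k hk).1) hw hv
    refine ⟨σ', fun k hkm => ⟨?_, hk k hkm⟩, fun k => (TS.run_succ_of_eq (hw' k)).trans (hstep k)⟩
    rcases Nat.lt_succ_iff_lt_or_eq.1 hkm with h | rfl
    · rw [hσ' k h]; exact (hσ k h).1
    · exact hτ
  · rintro ⟨σ, hσ, hw'⟩
    choose w hw hstep using fun k =>
      Option.bind_eq_some_iff.1 ((TS.run_succ _ _ _).symm.trans (hw' k))
    refine ⟨w, ⟨σ, fun k hk => hσ k (by omega), hw⟩, σ m, ?_, (hσ m (by omega)).1, hstep⟩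
    exact (keeps_iff_validAt (hrun σ fun k hk => (hσ k (by omega)).1) hw).1 (hσ m (by omega)).2

theorem restrict_state_eq_some {s : TS (A.inp i) (A.out i) T} {γ : ℕ → Letter (A.inp i)} {m : ℕ}
    {x : T × Set (∀ k, U k)} (hx : (restrict G i s).state γ m = some x) :
    s.state γ m = some x.1 ∧ x.2 = possible G i s γ m ∧ x.2.Nonempty := by
  induction m generalizing x with
  | zero =>
    obtain rfl : (restrict G i s).start = x := Option.some.inj hx
    refine ⟨rfl, ?_, Set.singleton_nonempty _⟩
    ext w
    simp only [restrict, possible, Set.mem_singleton_iff, TS.run_zero, Option.some.injEq]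
    constructor
    · rintro rfl
      exact ⟨fun _ => ∅, by simp, fun k => rfl⟩
    · rintro ⟨-, -, h⟩
      exact funext fun k => (h k).symm
  | succ m ih =>
    obtain ⟨y, hy, hst⟩ := Option.bind_eq_some_iff.1 hx
    obtain ⟨h1, h2, -⟩ := ih hy
    simp only [restrict] at hst
    split_ifs at hst with hne
    obtain ⟨t', ht', rfl⟩ := Option.map_eq_some_iff.1 hst
    refine ⟨by simp [TS.state, h1, ht'], ?_, hne⟩
    rw [← successors_possible h1, h2]

/-- A history kept through time `m` prevents both reasons for stopping: `s` continues by
certification, and the complete guarantee systems reach states that witness a nonempty successor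
set. -/
theorem restrict_state_succ {M : UCB V} {s : TS (A.inp i) (A.out i) T}
    (hG : ∀ i, (G i).Complete) (hs : Certified A G M i s)
    {γ : ℕ → Letter (A.inp i)} {m : ℕ} {x : T × Set (∀ k, U k)}
    (hx : (restrict G i s).state γ m = some x) {σ : ℕ → Finset V}
    (hσ : ∀ k ≤ m, cut (A.inp i) (σ k) = γ k ∧ Keeps A G i s σ k) :
    ∃ y, (restrict G i s).state γ (m + 1) = some y := by
  obtain ⟨h1, h2, -⟩ := restrict_state_eq_some hx
  obtain ⟨t', ht'⟩ := hs.continues σ m fun k hk => (hσ k hk).2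
  rw [TS.run, s.state_congr (fun k hk => (hσ k (by omega)).1)] at ht'
  have hne : (successors G i s x.1 x.2 (γ m)).Nonempty := by
    rw [h2, successors_possible h1]
    choose w hw using fun k => (hG k).exists_run σ (m + 1)
    exact ⟨w, σ, fun k hk => hσ k (by omega), hw⟩
  simp only [TS.state, h1, Option.bind_some] at ht'
  exact ⟨(t', successors G i s x.1 x.2 (γ m)), by
    simp only [TS.state, hx, Option.bind_some]
    simp [restrict, hne, ht']⟩

theorem restrict_comp {s : TS (A.inp i) (A.out i) T} {γ : ℕ → Letter (A.inp i)} {k : ℕ}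
    {c : Finset V} (h : (restrict G i s).comp γ k = some c) : s.comp γ k = some c := by
  obtain ⟨x, hx, rfl⟩ := Option.map_eq_some_iff.1 h
  simp [TS.comp, (restrict_state_eq_some hx).1, restrict]

theorem TS.infiniteComp_iff {I O : Finset V} {s : TS I O T} {γ : ℕ → Letter I} :
    s.InfiniteComp γ ↔ ∀ k, ∃ t, s.state γ k = some t := by
  simp [TS.InfiniteComp, TS.comp, Option.isSome_iff_exists]

/-- An infinite computation of the restriction belongs to a word on which the other processes
keep to their guarantees. -/
theorem exists_keeps_of_restrict_infinite {s : TS (A.inp i) (A.out i) T}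
    {γ : ℕ → Letter (A.inp i)} (hinf : (restrict G i s).InfiniteComp γ) :
    ∃ σ, ∀ k, cut (A.inp i) (σ k) = γ k ∧ Keeps A G i s σ k := by
  obtain ⟨σ, hσ⟩ := exists_word_of_prefixes
    (P := fun m σ => ∀ k < m, cut (A.inp i) (σ k) = γ k ∧ Keeps A G i s σ k)
    (fun m σ τ h hσ k hk => ⟨h k hk ▸ (hσ k hk).1,
      (hσ k hk).2.congr fun l hl => h l (by omega)⟩)
    (fun m σ h k hk => h k (by omega))
    (fun m => by
      obtain ⟨x, hx⟩ := TS.infiniteComp_iff.1 hinf m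
      obtain ⟨-, h2, w, hw⟩ := restrict_state_eq_some hx
      rw [h2] at hw
      obtain ⟨σ, hσ, -⟩ := hw
      exact ⟨σ, hσ⟩)
  exact ⟨σ, fun k => hσ (k + 1) k (by omega)⟩

/-- An infinite computation yields a kept word by compactness, and its projection is the required
`γ'`. Conversely, if the prefixes produced so far are valid histories, `restrict_state_succ` gives
one more step. -/
theorem restrict_isLocalStrategy {M : UCB V} {s : TS (A.inp i) (A.out i) T}
    (hG : ∀ i, (G i).Complete) (hs : Certified A G M i s) :
    IsLocalStrategy A G i (restrict G i s) := by
  intro γ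
  constructor
  · intro hinf
    obtain ⟨σ, hσ⟩ := exists_keeps_of_restrict_infinite hinf
    obtain rfl : (fun k => cut (A.inp i) (σ k)) = γ := funext fun k => (hσ k).1
    refine ⟨fun k => cut _ (σ k), fun t h hh => ?_⟩
    refine (validHistory_iff (σ := σ) fun m => ?_).2 fun j hj k _ => (hσ k).2.2 j hj
    have hem : (restrict G i s).Emits σ m := by
      obtain ⟨x, hx⟩ := TS.infiniteComp_iff.1 hinf m
      obtain ⟨t, ht, hl⟩ := (hσ m).2.1
      have := Option.some.inj (ht.symm.trans (restrict_state_eq_some hx).1)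
      subst this
      exact ⟨x, hx, hl⟩
    exact Option.some.inj
      (((TS.compWith_cut_iff (A.inp_disjoint_out i)).2 hem).symm.trans (hh m))
  · rintro ⟨γ', hγ'⟩
    rw [TS.infiniteComp_iff]
    -- The default `∅` is never relevant: `σ` is used only at times where the computation is already
    -- known to exist.
    let σ : ℕ → Finset V := fun k => ((restrict G i s).compWith γ γ' k).getD ∅
    intro m
    induction m using Nat.strong_induction_on with
    | _ m ih =>
      cases m with
      | zero => exact ⟨_, rfl⟩
      | succ m =>
        have hσ : ∀ k ≤ m, (restrict G i s).compWith γ γ' k = some (σ k) := by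
          intro k hk
          obtain ⟨x, hx⟩ := ih k (by omega)
          simp [σ, TS.compWith, TS.comp, hx]
        have hσ' := fun k hk =>
          (TS.compWith_eq_some_iff (A.inp_disjoint_out i)).1 (hσ k hk)
        have hvalid := (validHistory_iff (σ := σ) fun _ => rfl).1
          (hγ' (m + 1) (fun k => σ k) fun k => hσ k (by omega))
        obtain ⟨x, hx⟩ := ih m (by omega)
        refine restrict_state_succ hG hs hx (σ := σ) fun k hk => ⟨(hσ' k hk).1, ?_, ?_⟩
        · obtain ⟨-, -, y, hy, hl⟩ := hσ' k hk
          refine ⟨y.1, ?_, hl⟩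
          rw [TS.run, s.state_congr fun l hl => (hσ' l (by omega)).1]
          exact (restrict_state_eq_some hy).1
        · exact fun j hj => hvalid j hj k (by omega)

/-- States reached at the same time on the same inputs are related. A possible tuple of guarantee
states comes from a kept history, to which `agrees` applies. -/
theorem restrict_simulatedBy {M : UCB V} {s : TS (A.inp i) (A.out i) T}
    (hG : ∀ i, (G i).Complete) (hs : Certified A G M i s) :
    (restrict G i s).SimulatedBy (G i) := by
  refine ⟨fun x u => ∃ γ m, (restrict G i s).state γ m = some x ∧ (G i).state γ m = some u,
    ⟨fun _ => ⟨∅, Finset.empty_subset _⟩, 0, rfl, rfl⟩, ?_⟩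
  rintro x u ⟨γ, m, hx, hu⟩
  obtain ⟨h1, h2, w, hw⟩ := restrict_state_eq_some hx
  constructor
  · rw [h2] at hw
    obtain ⟨σ, hσ, -⟩ := hw
    have hγ : ∀ k < m, cut (A.inp i) (σ k) = γ k := fun k hk => (hσ k hk).1
    exact hs.agrees σ m (fun k hk => (hσ k hk).2) x.1 u ((s.state_congr hγ).trans h1)
      (((G i).state_congr hγ).trans hu)
  · intro e y hy
    obtain ⟨u', hu'⟩ := Option.isSome_iff_exists.1 (hG i u e)
    have hlt : ∀ k < m, Function.update γ m e k = γ k := fun k hk =>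
      Function.update_of_ne (by omega) _ _
    refine ⟨u', hu', Function.update γ m e, m + 1, ?_, ?_⟩
    · simp [TS.state, TS.state_congr _ hlt, hx, hy]
    · simp [TS.state, TS.state_congr _ hlt, hu, hu']

/-- The completion in `ρ` is arbitrary, whereas the others keep to their guarantees only for some
other completion `σ`. Both agree on `V_i`, which is why `accepts` allows for such a change. -/
theorem restrict_accepts {M : UCB V} {s : TS (A.inp i) (A.out i) T}
    (hs : Certified A G M i s) {γ γ'} {ρ : ℕ → Finset V}
    (hρ : ∀ k, (restrict G i s).compWith γ γ' k = some (ρ k)) : M.Accepts ρ := by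
  have hρ' := fun k => (TS.compWith_eq_some_iff (A.inp_disjoint_out i)).1 (hρ k)
  have hinf : (restrict G i s).InfiniteComp γ :=
    TS.infiniteComp_iff.2 fun k => ⟨_, (hρ' k).2.2.choose_spec.1⟩
  obtain ⟨σ, hσ⟩ := exists_keeps_of_restrict_infinite hinf
  refine hs.accepts σ ρ (fun k => (hσ k).2) fun k => ?_
  obtain ⟨h1, -, x, hx, hl⟩ := hρ' k
  obtain ⟨t, ht, hl'⟩ := (hσ k).2.1
  rw [TS.run, s.state_congr (fun l _ => (hσ l).1), (restrict_state_eq_some hx).1] at ht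
  obtain rfl := Option.some.inj ht
  have e1 : ρ k ∩ A.inp i = σ k ∩ A.inp i := congrArg Subtype.val (h1.trans (hσ k).1.symm)
  have e2 : ρ k ∩ A.out i = σ k ∩ A.out i := hl.symm.trans hl'
  rw [Architecture.vars, Finset.inter_union_distrib_left, Finset.inter_union_distrib_left, e1, e2]

/-- The subset construction has finitely many states, so they can be numbered without changing
computations. -/
theorem exists_isRestriction_of_certified [Finite T] [∀ k, Finite (U k)] {M : UCB V}
    {s : TS (A.inp i) (A.out i) T} (hG : ∀ i, (G i).Complete) (hs : Certified A G M i s) :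
    ∃ (m : ℕ) (s' : TS (A.inp i) (A.out i) (Fin m)), IsRestriction A G i s' s ∧
      s'.SimulatedBy (G i) ∧ ∀ γ γ' (σ : ℕ → Finset V),
        (∀ k, s'.compWith γ γ' k = some (σ k)) → M.Accepts σ := by
  obtain ⟨m, ⟨e⟩⟩ := Finite.exists_equiv_fin (T × Set (∀ k, U k))
  have hcomp : ((restrict G i s).rename e e.symm).comp = (restrict G i s).comp :=
    funext fun γ => TS.rename_comp e.symm_apply_apply γ
  refine ⟨m, (restrict G i s).rename e e.symm, ⟨?_, ?_⟩, ?_, ?_⟩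
  · have := restrict_isLocalStrategy hG hs
    simpa only [IsLocalStrategy, TS.InfiniteComp, TS.compWith, hcomp] using this
  · intro γ k c h
    rw [hcomp] at h
    exact restrict_comp h
  · have hid : (G i).rename id id = G i := by simp [TS.rename]
    rw [← hid]
    exact (restrict_simulatedBy hG hs).rename e.symm_apply_apply fun _ => rfl
  · intro γ γ' σ h
    simp only [TS.compWith, hcomp] at h
    exact restrict_accepts hs h

/-! ### From restrictions back to certified strategies -/

/-- A strategy with a restriction that is part of a solution with local strategies is
certified. -/
theorem certified_of_isRestriction {M : UCB V} {T' : Type*} {s : TS (A.inp i) (A.out i) T}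
    {s' : TS (A.inp i) (A.out i) T'} (hr : IsRestriction A G i s' s)
    (hsim : s'.SimulatedBy (G i))
    (hacc : ∀ γ γ' (σ : ℕ → Finset V), (∀ k, s'.compWith γ γ' k = some (σ k)) → M.Accepts σ) :
    Certified A G M i s := by
  have hlabel : ∀ σ k t', s'.run σ k = some t' →
      ∃ t, s.run σ k = some t ∧ (s'.label t').1 = (s.label t).1 := by
    intro σ k t' ht'
    have hc := hr.2 (fun m => cut (A.inp i) (σ m)) k
    obtain ⟨t, ht, -⟩ := Option.map_eq_some_iff.1
      (hc _ (Option.map_eq_some_iff.2 ⟨t', ht', rfl⟩))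
    exact ⟨t, ht, TS.label_eq_of_comp_eq (A.inp_disjoint_out i) hc ht' ht⟩
  have halive : ∀ σ m, (∀ k < m, Keeps A G i s σ k) → ∃ t', s'.run σ m = some t' := by
    intro σ m hk
    -- If `s'` had no state at time `m`, its computation would have at most `m` letters, all from a
    -- history on which the others keep to their guarantees; a local strategy would then have an
    -- infinite computation.
    by_contra hstuck
    refine hstuck (TS.infiniteComp_iff.1 ((hr.1 fun k => cut (A.inp i) (σ k)).2
      ⟨fun k => cut _ (σ k), fun t h hh => ?_⟩) m)
    have hh' := fun k : Fin t =>
      (TS.compWith_eq_some_iff (A.inp_disjoint_out i)).1 (hh k)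
    have htm : t ≤ m := by
      by_contra hlt
      obtain ⟨-, -, t', ht', -⟩ := hh' ⟨m, by omega⟩
      exact hstuck ⟨t', ht'⟩
    refine (validHistory_iff (σ := σ) fun k => ?_).2
      fun j hj k hkt => (hk k (by omega)).2 j hj
    obtain ⟨-, -, t', ht', -⟩ := hh' k
    obtain ⟨t₁, ht₁, hl₁⟩ := (hk k (by omega)).1
    obtain ⟨t₂, ht₂, hl₂⟩ := hlabel σ k t' ht'
    obtain rfl := Option.some.inj (ht₁.symm.trans ht₂)
    have : s'.Emits σ k := ⟨t', ht', hl₂.trans hl₁⟩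
    exact Option.some.inj
      (((TS.compWith_cut_iff (A.inp_disjoint_out i)).2 this).symm.trans (hh k))
  refine ⟨?_, ?_, ?_⟩
  · intro σ m hk t u ht hu
    obtain ⟨t', ht'⟩ := halive σ m hk
    obtain ⟨t₂, ht₂, hl⟩ := hlabel σ m t' ht'
    obtain rfl := Option.some.inj (ht.symm.trans ht₂)
    obtain ⟨u₂, hu₂, hl₂⟩ := hsim.label_eq ht'
    obtain rfl := Option.some.inj (hu.symm.trans hu₂)
    rw [← hl, hl₂]
  · intro σ m hk
    obtain ⟨t', ht'⟩ := halive σ (m + 1) fun k hkm => hk k (by omega)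
    obtain ⟨t, ht, -⟩ := hlabel σ (m + 1) t' ht'
    exact ⟨t, ht⟩
  · intro σ ρ hk hρ
    have e1 : ∀ k, ρ k ∩ A.inp i = σ k ∩ A.inp i := fun k =>
      inter_eq_of_subset Finset.subset_union_left (hρ k)
    have e2 : ∀ k, ρ k ∩ A.out i = σ k ∩ A.out i := fun k =>
      inter_eq_of_subset Finset.subset_union_right (hρ k)
    refine hacc (fun k => cut _ (ρ k)) (fun k => cut _ (ρ k)) ρ fun k =>
      (TS.compWith_cut_iff (A.inp_disjoint_out i)).2 ?_
    obtain ⟨t', ht'⟩ := halive σ k fun l _ => hk l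
    obtain ⟨t, ht, hl⟩ := hlabel σ k t' ht'
    obtain ⟨t₁, ht₁, hl₁⟩ := (hk k).1
    obtain rfl := Option.some.inj (ht.symm.trans ht₁)
    exact ⟨t', (s'.run_congr fun l _ => e1 l).trans ht', by rw [hl, hl₁, e2]⟩

end Restriction

section Parallel

set_option linter.unusedSectionVars false

variable {V : Type*} [Fintype V] [DecidableEq V] {n : ℕ} {A : Architecture V n}
  {T : Fin n → Type*} {U : Fin n → Type*}

/-! ### Parallel compositions -/

theorem LTL.sat_congr (f : LTL V) {σ τ : ℕ → Finset V}
    (h : ∀ k, σ k ∩ f.props = τ k ∩ f.props) : f.Sat σ ↔ f.Sat τ := by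
  induction f generalizing σ τ with
  | atom a => simpa [props, Sat] using congrArg (a ∈ ·) (h 0)
  | neg f ih => simp only [Sat, ih h]
  | disj f g ihf ihg =>
    simp only [Sat, ihf fun k => inter_eq_of_subset Finset.subset_union_left (h k),
      ihg fun k => inter_eq_of_subset Finset.subset_union_right (h k)]
  | conj f g ihf ihg =>
    simp only [Sat, ihf fun k => inter_eq_of_subset Finset.subset_union_left (h k),
      ihg fun k => inter_eq_of_subset Finset.subset_union_right (h k)]
  | next f ih => exact ih fun k => h (k + 1)
  | untl f g ihf ihg =>
    have hf : ∀ j, f.Sat (fun m => σ (m + j)) ↔ f.Sat (fun m => τ (m + j)) := fun j =>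
      ihf fun k => inter_eq_of_subset Finset.subset_union_left (h (k + j))
    have hg : ∀ j, g.Sat (fun m => σ (m + j)) ↔ g.Sat (fun m => τ (m + j)) := fun j =>
      ihg fun k => inter_eq_of_subset Finset.subset_union_right (h (k + j))
    simp only [Sat, hf, hg]

theorem Architecture.disjoint_envOut (A : Architecture V n) : Disjoint A.envOut A.allOut :=
  Finset.sdiff_disjoint

theorem Architecture.envOut_union_allOut (A : Architecture V n) :
    A.envOut ∪ A.allOut = Finset.univ := by
  ext v
  obtain ⟨i, hi⟩ := A.cover v
  simp only [Finset.mem_union] at hi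
  simp only [Architecture.envOut, Architecture.allInp, Architecture.allOut, Finset.mem_union,
    Finset.mem_sdiff, Finset.mem_biUnion, Finset.mem_univ, true_and, iff_true]
  by_cases h : ∃ j, v ∈ A.out j
  · exact .inr h
  · exact .inl ⟨⟨i, hi.resolve_right fun h' => h ⟨i, h'⟩⟩, h⟩

theorem Architecture.mem_out_unique (A : Architecture V n) {i j : Fin n} {v : V}
    (hi : v ∈ A.out i) (hj : v ∈ A.out j) : i = j := by
  by_contra h
  exact Finset.disjoint_left.1 (A.out_disjoint i j h) hi hj

/-- The labels of the strategies make up the outputs of a letter if and only if each of them is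
the respective part of the letter. -/
theorem biUnion_label_eq_iff {S : ∀ i, TS (A.inp i) (A.out i) (T i)} {t : ∀ i, T i}
    {σ : Finset V} :
    (Finset.univ.biUnion fun j => ((S j).label (t j)).1) = σ ∩ A.allOut ↔
      ∀ j, ((S j).label (t j)).1 = σ ∩ A.out j := by
  have hl : ∀ j v, v ∈ ((S j).label (t j)).1 → v ∈ A.out j := fun j v h =>
    ((S j).label (t j)).2 h
  constructor
  · intro h j
    ext v
    have hv := congrArg (v ∈ ·) h
    simp only [Finset.mem_biUnion, Finset.mem_univ, true_and, Finset.mem_inter,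
      Architecture.allOut, eq_iff_iff] at hv ⊢
    constructor
    · exact fun hvj => ⟨(hv.1 ⟨j, hvj⟩).1, hl j v hvj⟩
    · rintro ⟨hσ, hvj⟩
      obtain ⟨k, hk⟩ := hv.2 ⟨hσ, j, hvj⟩
      rwa [A.mem_out_unique hvj (hl k v hk)]
  · intro h
    ext v
    simp [h, Architecture.allOut]

/-- Environment outputs and process outputs together exhaust `V`, so the letter assembled inside
`parallel` is `σ` itself. -/
theorem parallel_step_eq_some_iff {S : ∀ i, TS (A.inp i) (A.out i) (T i)} {t t' : ∀ i, T i}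
    {σ : Finset V} (hl : ∀ j, ((S j).label (t j)).1 = σ ∩ A.out j) :
    (parallel A S).step t (cut A.envOut σ) = some t' ↔
      ∀ j, (S j).step (t j) (cut (A.inp j) σ) = some (t' j) := by
  have hσ : (cut A.envOut σ).1 ∪ (Finset.univ.biUnion fun j => ((S j).label (t j)).1) = σ := by
    rw [biUnion_label_eq_iff.2 hl, cut, ← Finset.inter_union_distrib_left,
      A.envOut_union_allOut, Finset.inter_univ]
  simp only [parallel, hσ]
  constructor
  · intro h j
    split_ifs at h with hx
    rw [← Option.some.inj h]
    exact (Option.some_get (hx j)).symm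
  · intro h
    rw [dif_pos fun j => by rw [h j]; rfl]
    exact congrArg some (funext fun j => by simp [h j])

/-- Stated for whole words, since the composition and its components stay in step only as long as
all earlier outputs match the word. -/
theorem parallel_emits_iff {S : ∀ i, TS (A.inp i) (A.out i) (T i)} {π : ℕ → Finset V} :
    (∀ k, (parallel A S).Emits π k) ↔ ∀ i k, (S i).Emits π k := by
  constructor
  · intro h
    choose t ht hl using h
    have hl' := fun k => biUnion_label_eq_iff.1 (hl k)
    have key : ∀ k i, (S i).run π k = some (t k i) := by
      intro k
      induction k with
      | zero =>
        intro i
        rw [← Option.some.inj (ht 0)]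
        rfl
      | succ k ih =>
        intro i
        rw [TS.run_succ_of_eq (ih i)]
        refine (parallel_step_eq_some_iff (hl' k)).1 ?_ i
        rw [← TS.run_succ_of_eq (ht k), ht]
    exact fun i k => ⟨t k i, key k i, hl' k i⟩
  · intro h
    choose t ht hl using h
    have key : ∀ k, (parallel A S).run π k = some fun i => t i k := by
      intro k
      induction k with
      | zero => exact congrArg some (funext fun i => Option.some.inj (ht i 0))
      | succ k ih =>
        rw [TS.run_succ_of_eq ih, parallel_step_eq_some_iff fun j => hl j k]
        intro j
        rw [← TS.run_succ_of_eq (ht j k), ht]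
    exact fun k => ⟨_, key k, biUnion_label_eq_iff.2 fun j => hl j k⟩

theorem parallel_satisfies_iff {S : ∀ i, TS (A.inp i) (A.out i) (T i)} {φ : Spec V} :
    (parallel A S).Satisfies φ ↔ ∀ π, (∀ i k, (S i).Emits π k) → φ.Sat π := by
  constructor
  · intro h π hπ
    exact h _ _ π fun k => (TS.compWith_cut_iff A.disjoint_envOut).2 (parallel_emits_iff.2 hπ k)
  · intro h γ γ' π hπ
    have hsplit := fun k => (TS.compWith_eq_some_iff A.disjoint_envOut).1 (hπ k)
    refine h π (parallel_emits_iff.1 fun k => (TS.compWith_cut_iff A.disjoint_envOut).1 ?_)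
    convert hπ k using 2
    · exact funext fun k => (hsplit k).1
    · exact funext fun k => (hsplit k).2.1

theorem parallel_complete {S : ∀ i, TS (A.inp i) (A.out i) (T i)} (hS : ∀ i, (S i).Complete) :
    (parallel A S).Complete := by
  intro t e
  simp only [parallel]
  rw [dif_pos fun i => hS i _ _]
  rfl

/-- Complete strategies have a joint computation for all outputs of the environment. -/
theorem exists_joint_computation {S : ∀ i, TS (A.inp i) (A.out i) (T i)}
    (hS : ∀ i, (S i).Complete) (σ : ℕ → Finset V) :
    ∃ π : ℕ → Finset V, (∀ k, π k ∩ A.envOut = σ k ∩ A.envOut) ∧ ∀ i k, (S i).Emits π k := by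
  let γ : ℕ → Letter A.envOut := fun k => cut _ (σ k)
  let γ' : ℕ → Letter (Finset.univ \ (A.envOut ∪ A.allOut)) := fun k => cut _ (σ k)
  have hsome : ∀ k, ∃ c, (parallel A S).compWith γ γ' k = some c := by
    intro k
    obtain ⟨t, ht⟩ := (parallel_complete hS).state_isSome γ k
    simp [TS.compWith, TS.comp, ht]
  choose π hπ using hsome
  have hsplit := fun k => (TS.compWith_eq_some_iff A.disjoint_envOut).1 (hπ k)
  refine ⟨π, fun k => congrArg Subtype.val (hsplit k).1,
    parallel_emits_iff.1 fun k => (TS.compWith_cut_iff A.disjoint_envOut).1 ?_⟩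
  convert hπ k using 2
  · exact funext fun k => (hsplit k).1
  · exact funext fun k => (hsplit k).2.1

/-! ### Soundness -/

/-- The transition system stays where it is instead of getting stuck. -/
def TS.complete {I O : Finset V} {X : Type*} (s : TS I O X) : TS I O X where
  start := s.start
  step t e := some ((s.step t e).getD t)
  label := s.label

theorem TS.complete_run {I O : Finset V} {X : Type*} {s : TS I O X} {σ : ℕ → Finset V} {k : ℕ}
    {t : X} (h : s.run σ k = some t) : s.complete.run σ k = some t := by
  induction k generalizing t with
  | zero => exact h
  | succ k ih =>
    obtain ⟨t₀, ht₀, hst⟩ := Option.bind_eq_some_iff.1 h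
    rw [TS.run_succ_of_eq (ih ht₀)]
    simp [TS.complete, hst]

/-- A joint computation of the completed certified strategies is one on which all processes keep
to their guarantees. -/
theorem keeps_of_emits_complete {M : Fin n → UCB V} {S : ∀ i, TS (A.inp i) (A.out i) (T i)}
    {G : ∀ i, TS (A.inp i) (A.guarOut i) (U i)} (hG : ∀ i, (G i).Complete)
    (hS : ∀ i, Certified A G (M i) i (S i)) {π : ℕ → Finset V}
    (hπ : ∀ i k, (S i).complete.Emits π k) (k : ℕ) : ∀ i, Keeps A G i (S i) π k := by
  induction k using Nat.strong_induction_on with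
  | _ k ih =>
    have hrun : ∀ i, (S i).Emits π k := by
      intro i
      obtain ⟨t, ht⟩ := (hS i).exists_run fun l hl => ih l hl i
      obtain ⟨t', ht', hl⟩ := hπ i k
      obtain rfl := Option.some.inj ((TS.complete_run ht).symm.trans ht')
      exact ⟨t, ht, hl⟩
    refine fun i => ⟨hrun i, fun j _ => ?_⟩
    obtain ⟨u, hu⟩ := (hG j).exists_run π k
    obtain ⟨t, ht, hl⟩ := hrun j
    refine ⟨u, hu, ?_⟩
    -- `agrees` at time `k` needs kept guarantees only strictly before `k`, so the mutual reliance
    -- of the processes is not circular.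
    rw [← (hS j).agrees π k (fun l hl => ih l hl j) t u ht hu, hl, Finset.inter_assoc,
      Finset.inter_eq_right.2 (A.guarOut_subset j)]

/-- No conjunct is lost: one that mentions an output goes to the owner of that variable, and the
others go to every process, of which there is at least one. -/
theorem sat_of_forall_decomp (hn : 0 < n) {φ : Spec V} {π : ℕ → Finset V}
    (h : ∀ i, (decomp A φ i).Sat π) : φ.Sat π := by
  intro ξ hξ
  by_cases hx : ξ.props ∩ A.allOut = ∅
  · exact h ⟨0, hn⟩ ξ (List.mem_filter.2 ⟨hξ, by simp [hx]⟩)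
  · obtain ⟨v, hv⟩ := Finset.nonempty_iff_ne_empty.2 hx
    rw [Finset.mem_inter, Architecture.allOut, Finset.mem_biUnion] at hv
    obtain ⟨hv, i, -, hi⟩ := hv
    have hne : (ξ.props ∩ A.out i).Nonempty := ⟨v, Finset.mem_inter.2 ⟨hv, hi⟩⟩
    exact h i ξ (List.mem_filter.2 ⟨hξ, by simp [hne]⟩)

/-- Completed certified strategies realize the specification. -/
theorem parallel_complete_satisfies (hn : 0 < n) {φ : Spec V} {M : Fin n → UCB V}
    (hM : Represents A φ M) {S : ∀ i, TS (A.inp i) (A.out i) (T i)}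
    {G : ∀ i, TS (A.inp i) (A.guarOut i) (U i)} (hG : ∀ i, (G i).Complete)
    (hS : ∀ i, Certified A G (M i) i (S i)) :
    (parallel A fun i => (S i).complete).Satisfies φ := by
  refine parallel_satisfies_iff.2 fun π hπ => sat_of_forall_decomp (A := A) hn fun i => ?_
  exact (hM i π).1 ((hS i).accepts π π (fun k => keeps_of_emits_complete hG hS hπ k i)
    fun _ => rfl)

/-! ### Completeness -/

/-- On a word on which process `i` follows its strategy and the other processes keep to their
guarantees, process `i` cannot tell the guarantee transition systems of the other processes from
their strategies. -/
theorem exists_joint_computation_of_keeps {S : ∀ i, TS (A.inp i) (A.out i) (T i)}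
    {G : ∀ i, TS (A.inp i) (A.guarOut i) (U i)} (hS : ∀ i, (S i).Complete)
    (hsim : ∀ i, (S i).SimulatedBy (G i)) {i : Fin n} {σ : ℕ → Finset V}
    (hk : ∀ k, Keeps A G i (S i) σ k) :
    ∃ π : ℕ → Finset V, (∀ j k, (S j).Emits π k) ∧ ∀ k, π k ∩ A.vars i = σ k ∩ A.vars i := by
  -- Let all strategies run against the environment outputs of `σ`.
  obtain ⟨π, henv, hπ⟩ := exists_joint_computation hS σ
  -- Equal inputs in the past put each strategy and each guarantee system into the same state on
  -- both words. Simulation then equates the guaranteed outputs, and an input variable is either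
  -- such an output or an output of the environment.
  have key : ∀ k, π k ∩ A.allInp = σ k ∩ A.allInp ∧ π k ∩ A.out i = σ k ∩ A.out i := by
    intro k
    induction k using Nat.strong_induction_on with
    | _ k ih =>
      have hin : ∀ j, ∀ m < k, π m ∩ A.inp j = σ m ∩ A.inp j := fun j m hm =>
        inter_eq_of_subset (A.inp_subset_allInp j) (ih m hm).1
      have hout : π k ∩ A.out i = σ k ∩ A.out i := by
        obtain ⟨t, ht, hl⟩ := hπ i k
        obtain ⟨t', ht', hl'⟩ := (hk k).1
        rw [(S i).run_congr (hin i), ht'] at ht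
        obtain rfl := Option.some.inj ht
        rw [← hl, hl']
      have hguar : ∀ j, π k ∩ A.guarOut j = σ k ∩ A.guarOut j := by
        intro j
        by_cases hj : j = i
        · subst hj
          exact inter_eq_of_subset (A.guarOut_subset j) hout
        · obtain ⟨t, ht, hl⟩ := hπ j k
          obtain ⟨u, hu, hlu⟩ := (hsim j).label_eq ht
          obtain ⟨u', hu', hlu'⟩ := (hk k).2 j hj
          have hu'' : (G j).run π k = some u := hu
          rw [(G j).run_congr (hin j), hu'] at hu''
          obtain rfl := Option.some.inj hu''
          rw [← hlu', ← hlu, hl, Finset.inter_assoc,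
            Finset.inter_eq_right.2 (A.guarOut_subset j)]
      refine ⟨?_, hout⟩
      ext v
      simp only [Finset.mem_inter]
      refine and_congr_left fun hv => ?_
      by_cases hvo : v ∈ A.allOut
      · obtain ⟨j, -, hj⟩ := Finset.mem_biUnion.1 hvo
        have hvg : v ∈ A.guarOut j := Finset.mem_inter.2 ⟨hj, hv⟩
        simpa [hvg] using congrArg (v ∈ ·) (hguar j)
      · have hve : v ∈ A.envOut := Finset.mem_sdiff.2 ⟨hv, hvo⟩
        simpa [hve] using congrArg (v ∈ ·) (henv k)
  refine ⟨π, hπ, fun k => ?_⟩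
  rw [Architecture.vars, Finset.inter_union_distrib_left, Finset.inter_union_distrib_left,
    inter_eq_of_subset (A.inp_subset_allInp i) (key k).1, (key k).2]

/-- Strategies that realize the specification and are simulated by guarantee transition systems
are certified if every process sees the variables of its subspecification. -/
theorem certified_of_satisfies {φ : Spec V} {M : Fin n → UCB V} (hM : Represents A φ M)
    {S : ∀ i, TS (A.inp i) (A.out i) (T i)} {G : ∀ i, TS (A.inp i) (A.guarOut i) (U i)}
    (hS : ∀ i, (S i).Complete) (hsim : ∀ i, (S i).SimulatedBy (G i))
    (hsat : ∀ π, (∀ i k, (S i).Emits π k) → φ.Sat π)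
    (hprops : ∀ i, ∀ ξ ∈ decomp A φ i, ξ.props ⊆ A.vars i) (i : Fin n) :
    Certified A G (M i) i (S i) := by
  refine ⟨?_, fun σ m _ => (hS i).exists_run σ (m + 1), ?_⟩
  · intro σ m _ t u ht hu
    obtain ⟨u', hu', hl⟩ := (hsim i).label_eq ht
    obtain rfl := Option.some.inj (hu.symm.trans hu')
    exact hl
  · intro σ ρ hk hρ
    obtain ⟨π, hπ, hv⟩ := exists_joint_computation_of_keeps hS hsim hk
    refine (hM i ρ).2 fun ξ hξ => ?_
    -- `ρ`, `σ` and the joint computation `π` agree on `V_i`, and `ξ` mentions nothing else.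
    refine (ξ.sat_congr fun k => ?_).1 (hsat π hπ ξ (List.mem_filter.1 hξ).1)
    exact inter_eq_of_subset (hprops i ξ hξ) ((hv k).trans (hρ k).symm)

/-- States can be renamed into a larger set such that a given state becomes the state `0`. -/
theorem exists_leftInverse_fin {m b : ℕ} (hmb : m ≤ b) (a : Fin m) (z : Fin b) :
    ∃ (f : Fin m → Fin b) (g : Fin b → Fin m), Function.LeftInverse g f ∧ f a = z := by
  let f : Fin m → Fin b := fun x => Equiv.swap (Fin.castLE hmb a) z (Fin.castLE hmb x)
  have hf : Function.Injective f := (Equiv.injective _).comp (Fin.castLE_injective hmb)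
  have : Nonempty (Fin m) := ⟨a⟩
  exact ⟨f, Function.invFun f, Function.leftInverse_invFun hf, Equiv.swap_apply_left _ _⟩

end Parallel

end CertSynth

end

/-! ### The theorem -/

open CertSynth in
theorem theorem4 {V : Type*} [Fintype V] [DecidableEq V] {n : ℕ} (hn : 2 ≤ n)
    (A : Architecture V n) (φ : Spec V) (B : Bounds n) :
    (∃ M : Fin n → UCB V, Represents A φ M) ∧
    ∀ M : Fin n → UCB V, Represents A φ M →
      -- every solution of the constraint system describes transition systems
      (∀ α : CVar A M B → Prop, (constraintSystem A M B).Eval α →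
        ∃ S G, Describes α S G) ∧
      -- the described systems are those that restrict to solutions with local strategies
      (∀ (S : ∀ i, TS (A.inp i) (A.out i) (B.S i))
          (G : ∀ i, TS (A.inp i) (A.guarOut i) (B.G i)),
        (∀ i, (S i).start = B.s0 i ∧ (G i).start = B.g0 i) →
        ((∃ α, (constraintSystem A M B).Eval α ∧ Describes α S G) ↔
          ∃ (m : Fin n → ℕ) (S' : ∀ i, TS (A.inp i) (A.out i) (Fin (m i))),
            (∀ i, IsRestriction A G i (S' i) (S i)) ∧ IsLocalSolution A M S' G)) ∧
      ((constraintSystem A M B).Satisfiable → Realizable A φ) ∧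
      (RealizableWithin A φ B → (∀ i, ∀ ξ ∈ decomp A φ i, ξ.props ⊆ A.vars i) →
        (constraintSystem A M B).Satisfiable) := by
  refine ⟨?_, fun M hM => ⟨fun α => exists_describes, ?_, ?_, ?_⟩⟩
  · choose M hM using fun i => exists_ucb_accepts_iff_sat (decomp A φ i)
    exact ⟨M, hM⟩
  · intro S G h0
    constructor
    · rintro ⟨α, he, hd⟩
      obtain ⟨hG, hS⟩ := certified_of_eval hd he
      choose m S' hr hsim hacc using fun i => exists_isRestriction_of_certified hG (hS i)
      exact ⟨m, S', hr, hG, fun i => ⟨(hr i).1, hsim i, hacc i⟩⟩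
    · rintro ⟨m, S', hr, hG, hS'⟩
      exact exists_eval_of_certified h0 hG fun i =>
        certified_of_isRestriction (hr i) (hS' i).2.1 (hS' i).2.2
  · rintro ⟨α, he⟩
    obtain ⟨S, G, hd⟩ := exists_describes he
    obtain ⟨hG, hS⟩ := certified_of_eval hd he
    exact ⟨_, fun i => (S i).complete, fun i t e => rfl,
      parallel_complete_satisfies (by omega) hM hG hS⟩
  · rintro ⟨m, l, S, G, hb, hSG, hsat⟩ hprops
    -- The given systems may be smaller than the bounds and start anywhere, while the constraint
    -- system fixes the exact sizes and the initial state `0`; so they are renumbered and padded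
    -- with copies of states.
    choose f g hgf hf0 using fun i =>
      exists_leftInverse_fin (hb i).1 (S i).start (B.s0 i)
    choose f' g' hgf' hf0' using fun i =>
      exists_leftInverse_fin (hb i).2 (G i).start (B.g0 i)
    obtain ⟨α, he, -⟩ := exists_eval_of_certified (M := M)
      (S := fun i => (S i).rename (f i) (g i)) (G := fun i => (G i).rename (f' i) (g' i))
      (fun i => ⟨hf0 i, hf0' i⟩) (fun i => (hSG i).2.1.rename _ _)
      (certified_of_satisfies hM (fun i => (hSG i).1.rename _ _)
        (fun i => (hSG i).2.2.rename (hgf i) (hgf' i))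
        (fun π hπ => parallel_satisfies_iff.1 hsat π
          fun i k => (TS.rename_emits (hgf i) π k).1 (hπ i k)) hprops)
    exact ⟨α, he⟩
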